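/- Consider a state-dependent channel with two transmitters, two receivers and a helper, with finite alphabets $\mathcal S,\mathcal X_0,\mathcal X_1,\mathcal X_2,\mathcal Y_1,\mathcal Y_2$. The state is i.i.d. with pmf $p(s)$, and the channel is memoryless with transition matrix $p(y_1,y_2|x_0,x_1,x_2,s)$. A $(2^{nR_1},2^{nR_2},n)$ code, with $R_1,R_2\ge 0$ and $\lceil 2^{nR_j}\rceil$ messages for user $j$, consists of a helper encoder $x_0^n(s^n)$ that knows the whole state sequence and no message, encoders $x_1^n(m_1)$ and $x_2^n(m_2)$, and decoders that map $y_1^n$ and $y_2^n$ to estimates $\hat m_1$ and $\hat m_2$ or to an error message. Its error probability is $P_e^{(n)}=\Pr\{\hat M_1\ne M_1\text{ or }\hat M_2\ne M_2\}$ for independent uniformly distributed messages. A pair $(R_1,R_2)$ is achievable if there is a sequence of $(2^{nR_1},2^{nR_2},n)$ codes with $P_e^{(n)}\to0$. The capacity region $\mathcal C$ is the closure of the set of achievable pairs. Information is measured in bits. (a) Let $\mathcal R$ be the set of pairs $R_1,R_2\ge0$ for which there are finite alphabets $\mathcal U,\mathcal V$ and a pmf of the form $p(u,v,x_0|s)\,p(x_1)\,p(x_2)$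 such that, for $(S,U,V,X_0,X_1,X_2,Y_1,Y_2)\sim p(s)\,p(u,v,x_0|s)\,p(x_1)\,p(x_2)\,p(y_1,y_2|x_0,x_1,x_2,s)$, $$R_1\le\min\{I(U,X_1;Y_1)-I(U;S),\ I(X_1;Y_1|U)\},$$ $$R_2\le\min\{I(V,X_2;Y_2)-I(V;S),\ I(X_2;Y_2|V)\},$$ $$R_1+R_2\le\min\{I(U,X_1;Y_1)-I(U;S)+I(V,X_2;Y_2)-I(V;S)-I(V;U|S),\ I(X_1;Y_1|U)+I(X_2;Y_2|V)\}.$$ Then $\mathcal R\subseteq\mathcal C$. (b) Let $\mathcal R'$ be the set of pairs $R_1,R_2\ge0$ for which there are finite alphabets $\mathcal U_1,\mathcal U_2$ and a pmf of the form $p(u_1,u_2,x_0|s)\,p(x_1)\,p(x_2)$ such that, for the corresponding joint law, $$R_1\le\min\{I(U_1,X_1;Y_1)-I(U_1;S),\ I(X_1;Y_1|U_1)\},$$ $$R_2\le\min\{I(U_2,X_2;Y_2)-I(U_2;U_1,S),\ I(X_2;Y_2|U_2)\}.$$ Then $\mathcal R'\subseteq\mathcal R$; in particular $\mathcal R'\subseteq\mathcal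 C$. -/

import Mathlib

open Filter Topology

noncomputable section

namespace HelperChannel

/-! ## Information measures on a finite probability space

A probability mass function on a finite set is an element of `stdSimplex ℝ Ω`; a random variable
is a function on `Ω`.  Information is measured in bits. -/

section Information

variable {Ω α β γ : Type*} [Fintype Ω] [Fintype α] [Fintype β] [Fintype γ]

open Classical in
/-- The probability that `X = a` under the probability mass function `P`. -/
def law (P : stdSimplex ℝ Ω) (X : Ω → α) (a : α) : ℝ :=
  ∑ ω, if X ω = a then P.1 ω else 0

/-- The mutual information `I(X;Y) = ∑ p(x,y) log₂ (p(x,y) / (p(x) p(y)))`.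
Terms with `p(x,y) = 0` vanish. -/
def mutualInfo (P : stdSimplex ℝ Ω) (X : Ω → α) (Y : Ω → β) : ℝ :=
  ∑ a, ∑ b, law P (fun ω => (X ω, Y ω)) (a, b) *
    Real.logb 2 (law P (fun ω => (X ω, Y ω)) (a, b) / (law P X a * law P Y b))

/-- The conditional mutual information
`I(X;Y|Z) = ∑ p(x,y,z) log₂ (p(x,y,z) p(z) / (p(x,z) p(y,z)))`.
Terms with `p(x,y,z) = 0` vanish. -/
def condMutualInfo (P : stdSimplex ℝ Ω) (X : Ω → α) (Y : Ω → β) (Z : Ω → γ) : ℝ :=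
  ∑ a, ∑ b, ∑ c, law P (fun ω => (X ω, Y ω, Z ω)) (a, b, c) *
    Real.logb 2 (law P (fun ω => (X ω, Y ω, Z ω)) (a, b, c) * law P Z c /
      (law P (fun ω => (X ω, Z ω)) (a, c) * law P (fun ω => (Y ω, Z ω)) (b, c)))

end Information

/-! ## The channel, codes and the capacity region -/

/-- A discrete memoryless state-dependent channel with two transmitters and a helper: the law
`p(s)` of the memoryless state and the transition matrix `p(y₁,y₂|x₀,x₁,x₂,s)`. -/
structure Channel (S X0 X1 X2 Y1 Y2 : Type*) [Fintype S] [Fintype Y1] [Fintype Y2] where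
  /-- the law `p(s)` of the state -/
  state : stdSimplex ℝ S
  /-- the transition matrix `p(y₁,y₂|x₀,x₁,x₂,s)` -/
  trans : X0 → X1 → X2 → S → stdSimplex ℝ (Y1 × Y2)

/-- A code of length `n` with `M1` and `M2` messages.  The helper knows the whole state sequence
but no message, and each encoder knows its own message only.  A decoder returns a message, or
`none` for an error message. -/
structure Code (S X0 X1 X2 Y1 Y2 : Type*) (M1 M2 n : ℕ) where
  /-- the encoder at the helper -/
  helper : (Fin n → S) → (Fin n → X0)
  /-- encoder 1 -/
  enc1 : Fin M1 → (Fin n → X1)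
  /-- encoder 2 -/
  enc2 : Fin M2 → (Fin n → X2)
  /-- decoder 1 -/
  dec1 : (Fin n → Y1) → Option (Fin M1)
  /-- decoder 2 -/
  dec2 : (Fin n → Y2) → Option (Fin M2)

section Capacity

variable {S X0 X1 X2 Y1 Y2 : Type*} [Fintype S] [Fintype Y1] [Fintype Y2]

/-- The average probability, over independent uniform messages, the memoryless state sequence and
the memoryless channel noise, that at least one decoder does not return the message sent. -/
def errorProb (ch : Channel S X0 X1 X2 Y1 Y2) {M1 M2 n : ℕ}
    (c : Code S X0 X1 X2 Y1 Y2 M1 M2 n) : ℝ :=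
  (∑ m1 : Fin M1, ∑ m2 : Fin M2, ∑ s : Fin n → S, ∑ y1 : Fin n → Y1, ∑ y2 : Fin n → Y2,
    if c.dec1 y1 = some m1 ∧ c.dec2 y2 = some m2 then 0
    else (∏ i, ch.state.1 (s i)) *
      ∏ i, (ch.trans (c.helper s i) (c.enc1 m1 i) (c.enc2 m2 i) (s i)).1 (y1 i, y2 i)) /
    ((M1 : ℝ) * (M2 : ℝ))

/-- The number `⌈2 ^ (n R)⌉` of messages of a code of length `n` and rate `R`. -/
def numMessages (R : ℝ) (n : ℕ) : ℕ := ⌈(2 : ℝ) ^ ((n : ℝ) * R)⌉₊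

/-- A pair of nonnegative rates is achievable if some sequence of `(2^{nR₁}, 2^{nR₂}, n)` codes
has average error probability tending to `0`. -/
def Achievable (ch : Channel S X0 X1 X2 Y1 Y2) (R : ℝ × ℝ) : Prop :=
  0 ≤ R.1 ∧ 0 ≤ R.2 ∧
    ∃ c : ∀ n : ℕ, Code S X0 X1 X2 Y1 Y2 (numMessages R.1 n) (numMessages R.2 n) n,
      Tendsto (fun n => errorProb ch (c n)) atTop (𝓝 0)

/-- The capacity region: the closure of the set of achievable rate pairs. -/
def capacityRegion (ch : Channel S X0 X1 X2 Y1 Y2) : Set (ℝ × ℝ) :=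
  closure {R | Achievable ch R}

end Capacity

/-! ## The two single-letter regions -/

/-- A choice of a probability mass function of the form `p(u,v,x₀|s) p(x₁) p(x₂)`. -/
structure InputLaw (S U V X0 X1 X2 : Type*) [Fintype U] [Fintype V] [Fintype X0] [Fintype X1]
    [Fintype X2] where
  /-- the conditional law `p(u,v,x₀|s)` -/
  aux : S → stdSimplex ℝ (U × V × X0)
  /-- the law `p(x₁)` -/
  input1 : stdSimplex ℝ X1
  /-- the law `p(x₂)` -/
  input2 : stdSimplex ℝ X2

/-- The sample space of the tuple `(S,U,V,X₀,X₁,X₂,Y₁,Y₂)`. -/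
abbrev Sample (S U V X0 X1 X2 Y1 Y2 : Type*) : Type _ := S × U × V × X0 × X1 × X2 × Y1 × Y2

section Region

variable {S U V X0 X1 X2 Y1 Y2 : Type*} [Fintype S] [Fintype U] [Fintype V] [Fintype X0]
  [Fintype X1] [Fintype X2] [Fintype Y1] [Fintype Y2]

/-- The joint law `p(s) p(u,v,x₀|s) p(x₁) p(x₂) p(y₁,y₂|x₀,x₁,x₂,s)`. -/
def jointLaw (ch : Channel S X0 X1 X2 Y1 Y2) (p : InputLaw S U V X0 X1 X2) :
    stdSimplex ℝ (Sample S U V X0 X1 X2 Y1 Y2) :=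
  ⟨fun ⟨s, u, v, x0, x1, x2, y1, y2⟩ =>
    ch.state.1 s * ((p.aux s).1 (u, v, x0) * (p.input1.1 x1 * (p.input2.1 x2 *
      (ch.trans x0 x1 x2 s).1 (y1, y2)))), by
    constructor
    · rintro ⟨s, u, v, x0, x1, x2, y1, y2⟩
      exact mul_nonneg (ch.state.2.1 _) (mul_nonneg ((p.aux s).2.1 _) (mul_nonneg
        (p.input1.2.1 _) (mul_nonneg (p.input2.2.1 _) ((ch.trans x0 x1 x2 s).2.1 _))))
    · have h1 : ∀ x0 x1 x2 s, ∑ y1, ∑ y2, (ch.trans x0 x1 x2 s).1 (y1, y2) = 1 := by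
        intro x0 x1 x2 s
        have h := (ch.trans x0 x1 x2 s).2.2
        rwa [Fintype.sum_prod_type] at h
      have h2 : ∀ s, ∑ u, ∑ v, ∑ x0, (p.aux s).1 (u, v, x0) = 1 := by
        intro s
        have h := (p.aux s).2.2
        simpa only [Fintype.sum_prod_type] using h
      have h3 := p.input1.2.2
      have h4 := p.input2.2.2
      have h5 := ch.state.2.2
      simp only [Fintype.sum_prod_type, ← Finset.mul_sum, h1, h2, h3, h4, h5, mul_one]⟩

/-- The set of the pairs `(R₁,R₂)` of nonnegative rates with
`R₁ ≤ min {I(U,X₁;Y₁) - I(U;S), I(X₁;Y₁|U)}`,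
`R₂ ≤ min {I(V,X₂;Y₂) - I(V;S), I(X₂;Y₂|V)}` and
`R₁ + R₂ ≤ min {I(U,X₁;Y₁) - I(U;S) + I(V,X₂;Y₂) - I(V;S) - I(V;U|S), I(X₁;Y₁|U) + I(X₂;Y₂|V)}`
under the joint law given by `p`. -/
def rateRegion (ch : Channel S X0 X1 X2 Y1 Y2) (p : InputLaw S U V X0 X1 X2) : Set (ℝ × ℝ) :=
  let P := jointLaw ch p
  let rvS : Sample S U V X0 X1 X2 Y1 Y2 → S := fun (s, _, _, _, _, _, _, _) => s
  let rvU : Sample S U V X0 X1 X2 Y1 Y2 → U := fun (_, u, _, _, _, _, _, _) => u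
  let rvV : Sample S U V X0 X1 X2 Y1 Y2 → V := fun (_, _, v, _, _, _, _, _) => v
  let rvX1 : Sample S U V X0 X1 X2 Y1 Y2 → X1 := fun (_, _, _, _, x1, _, _, _) => x1
  let rvX2 : Sample S U V X0 X1 X2 Y1 Y2 → X2 := fun (_, _, _, _, _, x2, _, _) => x2
  let rvY1 : Sample S U V X0 X1 X2 Y1 Y2 → Y1 := fun (_, _, _, _, _, _, y1, _) => y1
  let rvY2 : Sample S U V X0 X1 X2 Y1 Y2 → Y2 := fun (_, _, _, _, _, _, _, y2) => y2
  {R | 0 ≤ R.1 ∧ 0 ≤ R.2 ∧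
    R.1 ≤ min (mutualInfo P (fun ω => (rvU ω, rvX1 ω)) rvY1 - mutualInfo P rvU rvS)
      (condMutualInfo P rvX1 rvY1 rvU) ∧
    R.2 ≤ min (mutualInfo P (fun ω => (rvV ω, rvX2 ω)) rvY2 - mutualInfo P rvV rvS)
      (condMutualInfo P rvX2 rvY2 rvV) ∧
    R.1 + R.2 ≤ min
      (mutualInfo P (fun ω => (rvU ω, rvX1 ω)) rvY1 - mutualInfo P rvU rvS
        + mutualInfo P (fun ω => (rvV ω, rvX2 ω)) rvY2 - mutualInfo P rvV rvS
        - condMutualInfo P rvV rvU rvS)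
      (condMutualInfo P rvX1 rvY1 rvU + condMutualInfo P rvX2 rvY2 rvV)}

/-- The set of the pairs `(R₁,R₂)` of nonnegative rates with
`R₁ ≤ min {I(U₁,X₁;Y₁) - I(U₁;S), I(X₁;Y₁|U₁)}` and
`R₂ ≤ min {I(U₂,X₂;Y₂) - I(U₂;U₁,S), I(X₂;Y₂|U₂)}`
under the joint law given by `p`, where `U₁ = U` and `U₂ = V`. -/
def successiveRateRegion (ch : Channel S X0 X1 X2 Y1 Y2) (p : InputLaw S U V X0 X1 X2) :
    Set (ℝ × ℝ) :=
  let P := jointLaw ch p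
  let rvS : Sample S U V X0 X1 X2 Y1 Y2 → S := fun (s, _, _, _, _, _, _, _) => s
  let rvU1 : Sample S U V X0 X1 X2 Y1 Y2 → U := fun (_, u1, _, _, _, _, _, _) => u1
  let rvU2 : Sample S U V X0 X1 X2 Y1 Y2 → V := fun (_, _, u2, _, _, _, _, _) => u2
  let rvX1 : Sample S U V X0 X1 X2 Y1 Y2 → X1 := fun (_, _, _, _, x1, _, _, _) => x1
  let rvX2 : Sample S U V X0 X1 X2 Y1 Y2 → X2 := fun (_, _, _, _, _, x2, _, _) => x2
  let rvY1 : Sample S U V X0 X1 X2 Y1 Y2 → Y1 := fun (_, _, _, _, _, _, y1, _) => y1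
  let rvY2 : Sample S U V X0 X1 X2 Y1 Y2 → Y2 := fun (_, _, _, _, _, _, _, y2) => y2
  {R | 0 ≤ R.1 ∧ 0 ≤ R.2 ∧
    R.1 ≤ min (mutualInfo P (fun ω => (rvU1 ω, rvX1 ω)) rvY1 - mutualInfo P rvU1 rvS)
      (condMutualInfo P rvX1 rvY1 rvU1) ∧
    R.2 ≤ min (mutualInfo P (fun ω => (rvU2 ω, rvX2 ω)) rvY2
        - mutualInfo P rvU2 (fun ω => (rvU1 ω, rvS ω)))
      (condMutualInfo P rvX2 rvY2 rvU2)}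

end Region

section Bounds

variable {S X0 X1 X2 Y1 Y2 : Type*} [Fintype S] [Fintype X0] [Fintype X1] [Fintype X2]
  [Fintype Y1] [Fintype Y2]

/-- The union of the regions `rateRegion` over all finite alphabets of `U` and `V` and all
probability mass functions `p(u,v,x₀|s) p(x₁) p(x₂)`. -/
def innerBound (ch : Channel S X0 X1 X2 Y1 Y2) : Set (ℝ × ℝ) :=
  {R | ∃ (k l : ℕ) (p : InputLaw S (Fin k) (Fin l) X0 X1 X2), R ∈ rateRegion ch p}

/-- The union of the regions `successiveRateRegion` over all finite alphabets of `U₁` and `U₂` and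
all probability mass functions `p(u₁,u₂,x₀|s) p(x₁) p(x₂)`. -/
def successiveInnerBound (ch : Channel S X0 X1 X2 Y1 Y2) : Set (ℝ × ℝ) :=
  {R | ∃ (k l : ℕ) (p : InputLaw S (Fin k) (Fin l) X0 X1 X2), R ∈ successiveRateRegion ch p}

end Bounds

end HelperChannel

end

/-! Part (a) is proved by random coding. Four independent codebooks are drawn: helper words `u` and
`v` at rates `r1`, `r2`, and message words `x1`, `x2` at rates `R1`, `R2`. Given `s`, each triple of
a pair of helper words and a letter `x0` is weighted by the likelihood ratio p(u,v,x0|s) / (p(u)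
p(v)). This imitates the law p(u,v,x0|s) as soon as the empirical mean of the ratio over all pairs
of helper words concentrates. A second-moment computation (`avg_sq_sub_le`, `covering`) yields this
under r1 > I(U;S), r2 > I(V;S) and r1 + r2 > I(U;S) + I(V;S) + I(V;U|S).

Each decoder looks for a message that passes two likelihood tests together with some helper word,
without having to identify that word. A wrong message paired with the true helper word is excluded
when R1 < I(X1;Y1|U), and one paired with another helper word when R1 + r1 < I(U,X1;Y1); similarly
for user 2 (`avg_testDecoder_error_le`).

`exists_codeError_le` joins both estimates for a single channel use, with explicit thresholds.
Applied to the `n`-fold product channel, where the law of large numbers (`tendsto_sum_ind_density`)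
makes the thresholds typical, it gives `achievable_of_codebook_rates`. Eliminating r1 and r2
(`exists_codebook_rates`) leaves the region with strict inequalities, and the closure supplies its
boundary. A rate equal to zero needs care: a single message cannot be confused with another, so the
corresponding helper rate then has no upper limit.

Part (b) keeps the same input law: the chain rule turns I(V;U,S) into I(V;S) + I(V;U|S), and the
last term is nonnegative. -/

noncomputable section

namespace HelperChannel

/-! ### Averages over finite alphabets and over i.i.d. tuples. -/

section Average

variable {Ω U V : Type*} [Fintype Ω] [Fintype U] [Fintype V]

/-- The average of `f` under the weights `p`. -/
def avg (p : Ω → ℝ) (f : Ω → ℝ) : ℝ := ∑ a, p a * f a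

theorem avg_mono {p : Ω → ℝ} (hp : p ∈ stdSimplex ℝ Ω) {f g : Ω → ℝ} (h : ∀ a, f a ≤ g a) :
    avg p f ≤ avg p g :=
  Finset.sum_le_sum fun a _ => mul_le_mul_of_nonneg_left (h a) (hp.1 a)

theorem avg_nonneg {p : Ω → ℝ} (hp : p ∈ stdSimplex ℝ Ω) {f : Ω → ℝ} (h : ∀ a, 0 ≤ f a) :
    0 ≤ avg p f :=
  Finset.sum_nonneg fun a _ => mul_nonneg (hp.1 a) (h a)

theorem avg_add (p f g : Ω → ℝ) : avg p (fun a => f a + g a) = avg p f + avg p g := by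
  simp only [avg, mul_add, Finset.sum_add_distrib]

theorem avg_sub (p f g : Ω → ℝ) : avg p (fun a => f a - g a) = avg p f - avg p g := by
  simp only [avg, mul_sub, Finset.sum_sub_distrib]

theorem avg_const {p : Ω → ℝ} (hp : p ∈ stdSimplex ℝ Ω) (c : ℝ) : avg p (fun _ => c) = c := by
  simp only [avg, ← Finset.sum_mul, hp.2, one_mul]

theorem avg_mul_left (p f : Ω → ℝ) (c : ℝ) : avg p (fun a => c * f a) = c * avg p f := by
  simp only [avg, Finset.mul_sum]
  exact Finset.sum_congr rfl fun a _ => by ring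

theorem avg_mul_right (p f : Ω → ℝ) (c : ℝ) : avg p (fun a => f a * c) = avg p f * c := by
  simp only [avg, Finset.sum_mul, mul_assoc]

theorem avg_div (p f : Ω → ℝ) (c : ℝ) : avg p (fun a => f a / c) = avg p f / c := by
  simp only [div_eq_mul_inv, avg_mul_right]

theorem avg_sum {ι : Type*} (p : Ω → ℝ) (s : Finset ι) (f : ι → Ω → ℝ) :
    avg p (fun a => ∑ i ∈ s, f i a) = ∑ i ∈ s, avg p (f i) := by
  simp only [avg, Finset.mul_sum]
  exact Finset.sum_comm

theorem avg_comm (p : U → ℝ) (q : V → ℝ) (f : U → V → ℝ) :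
    avg p (fun a => avg q (fun b => f a b)) = avg q (fun b => avg p (fun a => f a b)) := by
  simp only [avg, Finset.mul_sum]
  rw [Finset.sum_comm]
  exact Finset.sum_congr rfl fun b _ => Finset.sum_congr rfl fun a _ => by ring

/-- Derandomisation: this fixes the random codebooks one after another. -/
theorem exists_le_of_avg_le {p : Ω → ℝ} (hp : p ∈ stdSimplex ℝ Ω) {f : Ω → ℝ} {B : ℝ}
    (h : avg p f ≤ B) : ∃ a, f a ≤ B := by
  by_contra! hc
  have h0 : avg p (fun a => f a - B) ≤ 0 := by
    rw [avg_sub, avg_const hp]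
    linarith
  have hnn : ∀ a ∈ Finset.univ, 0 ≤ p a * (f a - B) := fun a _ =>
    mul_nonneg (hp.1 a) (sub_nonneg.2 (hc a).le)
  have hz := (Finset.sum_eq_zero_iff_of_nonneg hnn).1 (le_antisymm h0 (Finset.sum_nonneg hnn))
  have hp0 : ∀ a, p a = 0 := fun a =>
    (mul_eq_zero.1 (hz a (Finset.mem_univ a))).resolve_right (sub_pos.2 (hc a)).ne'
  have := hp.2
  simp [hp0] at this

theorem sq_avg_le {p : Ω → ℝ} (hp : p ∈ stdSimplex ℝ Ω) (f : Ω → ℝ) :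
    avg p f ^ 2 ≤ avg p (fun a => f a ^ 2) := by
  have h := avg_nonneg hp (f := fun a => (f a - avg p f) ^ 2) fun a => sq_nonneg _
  have e : avg p (fun a => (f a - avg p f) ^ 2) = avg p (fun a => f a ^ 2) - avg p f ^ 2 := by
    have : (fun a => (f a - avg p f) ^ 2)
        = fun a => (f a ^ 2 - 2 * avg p f * f a) + avg p f ^ 2 := by
      funext a; ring
    rw [this, avg_add, avg_sub, avg_mul_left, avg_const hp]
    ring
  linarith

/-- The law of a tuple of independent samples from `p`. -/
def iid (p : U → ℝ) {L : ℕ} (c : Fin L → U) : ℝ := ∏ l, p (c l)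

theorem sum_pi_prod {n : ℕ} (f : Fin n → U → ℝ) :
    ∑ c : Fin n → U, ∏ i, f i (c i) = ∏ i, ∑ a, f i a := by
  rw [Finset.prod_univ_sum, Fintype.piFinset_univ]

theorem iid_mem {p : U → ℝ} (hp : p ∈ stdSimplex ℝ U) (L : ℕ) :
    iid p (L := L) ∈ stdSimplex ℝ (Fin L → U) := by
  refine ⟨fun c => Finset.prod_nonneg fun l _ => hp.1 _, ?_⟩
  simp only [iid]
  rw [sum_pi_prod (fun _ => p)]
  simp [hp.2]

theorem avg_iid_apply {p : U → ℝ} (hp : p ∈ stdSimplex ℝ U) {L : ℕ} (l : Fin L) (f : U → ℝ) :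
    avg (iid p) (fun c : Fin L → U => f (c l)) = avg p f := by
  have h1 : ∀ c : Fin L → U, iid p c * f (c l)
      = ∏ k, (p (c k) * if k = l then f (c k) else 1) := by
    intro c
    rw [Finset.prod_mul_distrib, Finset.prod_ite_eq' Finset.univ l]
    simp [iid]
  simp only [avg, h1]
  rw [sum_pi_prod (fun k a => p a * if k = l then f a else 1), Finset.prod_eq_single l]
  · simp
  · intro b _ hb
    simp [hb, hp.2]
  · simp

theorem avg_iid_mul {p : U → ℝ} (hp : p ∈ stdSimplex ℝ U) {L : ℕ} {l l' : Fin L} (hl : l' ≠ l)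
    (f g : U → ℝ) :
    avg (iid p) (fun c : Fin L → U => f (c l) * g (c l')) = avg p f * avg p g := by
  have h1 : ∀ c : Fin L → U, iid p c * (f (c l) * g (c l'))
      = ∏ k, (p (c k) * ((if k = l then f (c k) else 1) * if k = l' then g (c k) else 1)) := by
    intro c
    rw [Finset.prod_mul_distrib, Finset.prod_mul_distrib, Finset.prod_ite_eq' Finset.univ l,
      Finset.prod_ite_eq' Finset.univ l']
    simp [iid]
  simp only [avg, h1]
  rw [sum_pi_prod (fun k a => p a * ((if k = l then f a else 1) * if k = l' then g a else 1)),
    ← Finset.mul_prod_erase _ _ (Finset.mem_univ l),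
    ← Finset.mul_prod_erase _ _ (Finset.mem_erase.2 ⟨hl, Finset.mem_univ l'⟩),
    Finset.prod_eq_one]
  · simp [hl, hl.symm]
  · intro k hk
    simp only [Finset.mem_erase] at hk
    simp [hk.1, hk.2.1, hp.2]

/-- Expanding `F` along the indicators of the value of `c l` reduces the claim to products, hence to
`avg_iid_mul`. -/
theorem avg_iid_apply₂ {p : U → ℝ} (hp : p ∈ stdSimplex ℝ U) {L : ℕ} {l l' : Fin L} (hl : l' ≠ l)
    (F : U → U → ℝ) :
    avg (iid p) (fun c : Fin L → U => F (c l) (c l')) = avg p (fun u => avg p (F u)) := by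
  classical
  have h1 : (fun c : Fin L → U => F (c l) (c l'))
      = fun c => ∑ u, (if c l = u then (1 : ℝ) else 0) * F u (c l') := by
    funext c; simp
  rw [h1, avg_sum]
  have h2 : ∀ u, avg (iid p) (fun c : Fin L → U => (if c l = u then (1 : ℝ) else 0) * F u (c l'))
      = p u * avg p (F u) := by
    intro u
    rw [avg_iid_mul hp hl (fun a => if a = u then (1 : ℝ) else 0) (F u)]
    simp [avg]
  simp only [h2]
  rfl

end Average

/-! ### The threshold decoder and its average error. -/

section Decoder

variable {U X Y : Type*}

open Classical in
/-- The indicator of a proposition. -/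
def ind (p : Prop) : ℝ := if p then 1 else 0

theorem ind_nonneg (p : Prop) : 0 ≤ ind p := by unfold ind; split_ifs <;> norm_num

theorem ind_le_one (p : Prop) : ind p ≤ 1 := by unfold ind; split_ifs <;> norm_num

theorem ind_of_true {p : Prop} (h : p) : ind p = 1 := by simp [ind, h]

theorem ind_of_false {p : Prop} (h : ¬p) : ind p = 0 := by simp [ind, h]

theorem ind_or_le (p q : Prop) : ind (p ∨ q) ≤ ind p + ind q := by
  unfold ind; split_ifs <;> first | (exfalso; tauto) | norm_num

open Classical in
/-- The decoder that returns some message `m` for which a triple `(u_l, x_m, y)` passes the test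
`T`. -/
def testDecoder (T : U → X → Y → Prop) {L M : ℕ} (cu : Fin L → U) (cx : Fin M → X) (y : Y) :
    Option (Fin M) :=
  if h : ∃ m, ∃ l, T (cu l) (cx m) y then some h.choose else none

/-- Union bound: an error needs the true triple to be rejected or a wrong message to pass with some
helper word. The right message found through a wrong `l'` is harmless. The index `l` is kept apart
because `y` depends on the word `cu l`. -/
theorem ind_testDecoder_le (T : U → X → Y → Prop) {L M : ℕ} (cu : Fin L → U) (cx : Fin M → X)
    (y : Y) (l : Fin L) (m : Fin M) :
    ind (testDecoder T cu cx y ≠ some m) ≤ ind (¬T (cu l) (cx m) y)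
      + ∑ m' ∈ Finset.univ.erase m, (ind (T (cu l) (cx m') y)
        + ∑ l' ∈ Finset.univ.erase l, ind (T (cu l') (cx m') y)) := by
  have hin : ∀ m', 0 ≤ ∑ l' ∈ Finset.univ.erase l, ind (T (cu l') (cx m') y) := fun m' =>
    Finset.sum_nonneg fun _ _ => ind_nonneg _
  have hnn : ∀ m', 0 ≤ ind (T (cu l) (cx m') y)
      + ∑ l' ∈ Finset.univ.erase l, ind (T (cu l') (cx m') y) := fun m' =>
    add_nonneg (ind_nonneg _) (hin m')
  by_cases hT : T (cu l) (cx m) y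
  · have h : ∃ m, ∃ l, T (cu l) (cx m) y := ⟨m, l, hT⟩
    have hd : testDecoder T cu cx y = some h.choose := dif_pos h
    by_cases hm : h.choose = m
    · rw [ind_of_false (by rw [hd, hm]; simp)]
      exact add_nonneg (ind_nonneg _) (Finset.sum_nonneg fun m' _ => hnn m')
    · obtain ⟨l', hl'⟩ := h.choose_spec
      have h1 : 1 ≤ ind (T (cu l) (cx h.choose) y)
          + ∑ l' ∈ Finset.univ.erase l, ind (T (cu l') (cx h.choose) y) := by
        by_cases hll : l' = l
        · subst hll
          rw [ind_of_true hl']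
          linarith [hin h.choose]
        · have := Finset.single_le_sum (f := fun l' => ind (T (cu l') (cx h.choose) y))
            (fun i _ => ind_nonneg _) (Finset.mem_erase.2 ⟨hll, Finset.mem_univ l'⟩)
          simp only [ind_of_true hl'] at this
          linarith [ind_nonneg (T (cu l) (cx h.choose) y)]
      have h2 := Finset.single_le_sum (f := fun m' => ind (T (cu l) (cx m') y)
          + ∑ l' ∈ Finset.univ.erase l, ind (T (cu l') (cx m') y)) (fun i _ => hnn i)
          (Finset.mem_erase.2 ⟨hm, Finset.mem_univ h.choose⟩)
      linarith [ind_le_one (testDecoder T cu cx y ≠ some m), ind_nonneg (¬T (cu l) (cx m) y)]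
  · rw [ind_of_true hT]
    linarith [ind_le_one (testDecoder T cu cx y ≠ some m),
      Finset.sum_nonneg fun m' (_ : m' ∈ Finset.univ.erase m) => hnn m']

variable [Fintype U] [Fintype X] [Fintype Y]

/-- The kernel `k` need not be normalised; being dominated by the joint law `J` is enough. The word
of a wrong message is independent of `y`, so a change of measure through the tests bounds its chance
of passing by `1 / b` with the true helper word and by `1 / a` with another one. The factor `M - 1`
is kept because it vanishes for a single message. -/
theorem avg_testDecoder_error_le {pU : U → ℝ} (hU : pU ∈ stdSimplex ℝ U) {q : X → ℝ}
    (hq : q ∈ stdSimplex ℝ X) {k J : U → X → Y → ℝ} (hk : ∀ u x y, 0 ≤ k u x y)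
    (hJ0 : ∀ u x y, 0 ≤ J u x y)
    (hkJ : ∀ u x y, pU u * (q x * k u x y) ≤ J u x y) (hJ1 : ∑ u, ∑ x, ∑ y, J u x y ≤ 1)
    {a b : ℝ} (ha : 0 < a) (hb : 0 < b) (T : U → X → Y → Prop)
    (hTa : ∀ u x y, T u x y → a * (pU u * (q x * ∑ u, ∑ x, J u x y)) ≤ J u x y)
    (hTb : ∀ u x y, T u x y → b * (q x * ∑ x, J u x y) ≤ J u x y)
    {L M : ℕ} (l : Fin L) (m : Fin M) :
    avg (iid pU) (fun cu : Fin L → U => avg (iid q) fun cx : Fin M → X =>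
      ∑ y, k (cu l) (cx m) y * ind (testDecoder T cu cx y ≠ some m))
    ≤ ∑ u, ∑ x, ∑ y, J u x y * ind (¬T u x y) + ((M : ℝ) - 1) * (L / a + 1 / b) := by
  have hTb' : ∀ u x y, q x * (∑ x, J u x y) * ind (T u x y) ≤ J u x y / b := by
    intro u x y
    by_cases h : T u x y
    · rw [ind_of_true h, le_div_iff₀ hb]
      linarith [hTb u x y h]
    · rw [ind_of_false h, mul_zero]
      exact div_nonneg (hJ0 u x y) hb.le
  have hTa' : ∀ u x y, pU u * (q x * ∑ u, ∑ x, J u x y) * ind (T u x y) ≤ J u x y / a := by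
    intro u x y
    by_cases h : T u x y
    · rw [ind_of_true h, le_div_iff₀ ha]
      linarith [hTa u x y h]
    · rw [ind_of_false h, mul_zero]
      exact div_nonneg (hJ0 u x y) ha.le
  have e1 : avg (iid pU) (fun cu : Fin L → U => avg (iid q) fun cx : Fin M → X =>
      ∑ y, k (cu l) (cx m) y * ind (¬T (cu l) (cx m) y))
      ≤ ∑ u, ∑ x, ∑ y, J u x y * ind (¬T u x y) := by
    have inner : ∀ cu : Fin L → U, avg (iid q) (fun cx : Fin M → X =>
        ∑ y, k (cu l) (cx m) y * ind (¬T (cu l) (cx m) y))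
        = avg q fun x => ∑ y, k (cu l) x y * ind (¬T (cu l) x y) := fun cu =>
      avg_iid_apply hq m (fun x => ∑ y, k (cu l) x y * ind (¬T (cu l) x y))
    simp only [inner]
    rw [avg_iid_apply hU l (fun u => avg q fun x => ∑ y, k u x y * ind (¬T u x y))]
    simp only [avg, Finset.mul_sum]
    refine Finset.sum_le_sum fun u _ => Finset.sum_le_sum fun x _ => Finset.sum_le_sum fun y _ => ?_
    calc pU u * (q x * (k u x y * ind (¬T u x y)))
        = pU u * (q x * k u x y) * ind (¬T u x y) := by ring
      _ ≤ _ := mul_le_mul_of_nonneg_right (hkJ u x y) (ind_nonneg _)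
  -- True helper word: once the transmitted `x` is averaged out, the law of `(u, x', y)` is
  -- dominated by `q x'` times the `(u, y)` marginal of `J`, which is the reference law of `hTb`.
  have e2 : ∀ m' ∈ Finset.univ.erase m,
      avg (iid pU) (fun cu : Fin L → U => avg (iid q) fun cx : Fin M → X =>
      ∑ y, k (cu l) (cx m) y * ind (T (cu l) (cx m') y)) ≤ 1 / b := by
    intro m' hm'
    have inner : ∀ cu : Fin L → U, avg (iid q) (fun cx : Fin M → X =>
        ∑ y, k (cu l) (cx m) y * ind (T (cu l) (cx m') y))
        = avg q fun x => avg q fun x' => ∑ y, k (cu l) x y * ind (T (cu l) x' y) := fun cu =>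
      avg_iid_apply₂ hq (Finset.mem_erase.1 hm').1
        (fun x x' => ∑ y, k (cu l) x y * ind (T (cu l) x' y))
    simp only [inner]
    rw [avg_iid_apply hU l (fun u => avg q fun x => avg q fun x' =>
      ∑ y, k u x y * ind (T u x' y))]
    calc avg pU (fun u => avg q fun x => avg q fun x' => ∑ y, k u x y * ind (T u x' y))
        = ∑ u, ∑ x', ∑ y, q x' * (∑ x, pU u * (q x * k u x y)) * ind (T u x' y) := by
          simp only [avg, Finset.mul_sum, Finset.sum_mul]
          refine Finset.sum_congr rfl fun u _ => ?_
          rw [Finset.sum_comm]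
          refine Finset.sum_congr rfl fun x' _ => ?_
          rw [Finset.sum_comm]
          exact Finset.sum_congr rfl fun y _ => Finset.sum_congr rfl fun x _ => by ring
      _ ≤ ∑ u, ∑ x', ∑ y, J u x' y / b := by
          refine Finset.sum_le_sum fun u _ => Finset.sum_le_sum fun x' _ =>
            Finset.sum_le_sum fun y _ => le_trans ?_ (hTb' u x' y)
          exact mul_le_mul_of_nonneg_right (mul_le_mul_of_nonneg_left
            (Finset.sum_le_sum fun x _ => hkJ u x y) (hq.1 x')) (ind_nonneg _)
      _ = (∑ u, ∑ x', ∑ y, J u x' y) / b := by simp only [Finset.sum_div]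
      _ ≤ 1 / b := by gcongr
  -- Another helper word: `u'` and `x'` are both independent of `y`, so the dominating law is the
  -- product in `hTa`.
  have e3 : ∀ m' ∈ Finset.univ.erase m, ∀ l' ∈ Finset.univ.erase l,
      avg (iid pU) (fun cu : Fin L → U => avg (iid q) fun cx : Fin M → X =>
      ∑ y, k (cu l) (cx m) y * ind (T (cu l') (cx m') y)) ≤ 1 / a := by
    intro m' hm' l' hl'
    have inner : ∀ cu : Fin L → U, avg (iid q) (fun cx : Fin M → X =>
        ∑ y, k (cu l) (cx m) y * ind (T (cu l') (cx m') y))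
        = avg q fun x => avg q fun x' => ∑ y, k (cu l) x y * ind (T (cu l') x' y) := fun cu =>
      avg_iid_apply₂ hq (Finset.mem_erase.1 hm').1
        (fun x x' => ∑ y, k (cu l) x y * ind (T (cu l') x' y))
    simp only [inner]
    rw [avg_iid_apply₂ hU (Finset.mem_erase.1 hl').1 (fun u u' => avg q fun x => avg q fun x' =>
      ∑ y, k u x y * ind (T u' x' y))]
    calc avg pU (fun u => avg pU fun u' => avg q fun x => avg q fun x' =>
          ∑ y, k u x y * ind (T u' x' y))
        = ∑ u', ∑ x', ∑ y, pU u' * (q x' * ∑ u, ∑ x, pU u * (q x * k u x y))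
            * ind (T u' x' y) := by
          simp only [avg, Finset.mul_sum, Finset.sum_mul]
          rw [Finset.sum_comm]
          refine Finset.sum_congr rfl fun u' _ => ?_
          calc _ = ∑ u, ∑ x', ∑ x, ∑ y,
                pU u * (pU u' * (q x * (q x' * (k u x y * ind (T u' x' y))))) :=
                Finset.sum_congr rfl fun u _ => Finset.sum_comm
            _ = ∑ x', ∑ u, ∑ x, ∑ y,
                pU u * (pU u' * (q x * (q x' * (k u x y * ind (T u' x' y))))) := Finset.sum_comm
            _ = ∑ x', ∑ u, ∑ y, ∑ x,
                pU u * (pU u' * (q x * (q x' * (k u x y * ind (T u' x' y))))) :=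
                Finset.sum_congr rfl fun x' _ => Finset.sum_congr rfl fun u _ => Finset.sum_comm
            _ = _ := by
                refine Finset.sum_congr rfl fun x' _ => ?_
                rw [Finset.sum_comm]
                exact Finset.sum_congr rfl fun y _ => Finset.sum_congr rfl fun u _ =>
                  Finset.sum_congr rfl fun x _ => by ring
      _ ≤ ∑ u', ∑ x', ∑ y, J u' x' y / a := by
          refine Finset.sum_le_sum fun u' _ => Finset.sum_le_sum fun x' _ =>
            Finset.sum_le_sum fun y _ => le_trans ?_ (hTa' u' x' y)
          exact mul_le_mul_of_nonneg_right (mul_le_mul_of_nonneg_left (mul_le_mul_of_nonneg_left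
            (Finset.sum_le_sum fun u _ => Finset.sum_le_sum fun x _ => hkJ u x y) (hq.1 x'))
            (hU.1 u')) (ind_nonneg _)
      _ = (∑ u, ∑ x', ∑ y, J u x' y) / a := by simp only [Finset.sum_div]
      _ ≤ 1 / a := by gcongr
  have hM : (1 : ℝ) ≤ M := by exact_mod_cast Nat.one_le_iff_ne_zero.2 (Fin.pos m).ne'
  have hcard : ((Finset.univ.erase m).card : ℝ) = M - 1 := by
    rw [Finset.card_erase_of_mem (Finset.mem_univ m), Finset.card_fin,
      Nat.cast_sub (Fin.pos m), Nat.cast_one]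
  have hcardL : ((Finset.univ.erase l).card : ℝ) ≤ L := by
    exact_mod_cast (Finset.card_le_univ _).trans (by simp)
  calc _ ≤ avg (iid pU) (fun cu : Fin L → U => avg (iid q) fun cx : Fin M → X =>
        (∑ y, k (cu l) (cx m) y * ind (¬T (cu l) (cx m) y))
        + ∑ m' ∈ Finset.univ.erase m, ((∑ y, k (cu l) (cx m) y * ind (T (cu l) (cx m') y))
          + ∑ l' ∈ Finset.univ.erase l, ∑ y, k (cu l) (cx m) y * ind (T (cu l') (cx m') y))) := by
        refine avg_mono (iid_mem hU L) fun cu => avg_mono (iid_mem hq M) fun cx => ?_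
        calc _ ≤ ∑ y, k (cu l) (cx m) y * (ind (¬T (cu l) (cx m) y)
            + ∑ m' ∈ Finset.univ.erase m, (ind (T (cu l) (cx m') y)
            + ∑ l' ∈ Finset.univ.erase l, ind (T (cu l') (cx m') y))) :=
              Finset.sum_le_sum fun y _ => mul_le_mul_of_nonneg_left
                (ind_testDecoder_le T cu cx y l m) (hk _ _ _)
          _ = _ := by
              simp only [mul_add, Finset.sum_add_distrib, Finset.mul_sum]
              congr 1
              congr 1
              · exact Finset.sum_comm
              · rw [Finset.sum_comm]
                exact Finset.sum_congr rfl fun m' _ => Finset.sum_comm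
    _ ≤ ∑ u, ∑ x, ∑ y, J u x y * ind (¬T u x y) + ∑ m' ∈ Finset.univ.erase m,
          (1 / b + ∑ l' ∈ Finset.univ.erase l, 1 / a) := by
        simp only [avg_sum] at e1 e2 e3
        simp only [avg_add, avg_sum]
        refine add_le_add e1 (Finset.sum_le_sum fun m' hm' => add_le_add (e2 m' hm')
          (Finset.sum_le_sum fun l' hl' => e3 m' hm' l' hl'))
    _ ≤ _ := by
        rw [Finset.sum_const, Finset.sum_const, nsmul_eq_mul, nsmul_eq_mul, hcard]
        have : ((Finset.univ.erase l).card : ℝ) * (1 / a) ≤ L / a := by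
          rw [mul_one_div]; gcongr
        have := mul_le_mul_of_nonneg_left this (sub_nonneg.2 hM)
        nlinarith

end Decoder

/-! ### Concentration over a product of two random codebooks. -/

section Covering

variable {S U V : Type*} [Fintype S] [Fintype U] [Fintype V]

/-- One bound for equal and for distinct indices, so that double sums over a codebook reduce to
counting coincidences. -/
theorem avg_iid_pair_le {p : U → ℝ} (hp : p ∈ stdSimplex ℝ U) {L : ℕ} (l l' : Fin L)
    {F : U → U → ℝ} (hF : ∀ u u', 0 ≤ F u u') :
    avg (iid p) (fun c : Fin L → U => F (c l) (c l'))
      ≤ avg p (fun u => avg p (F u)) + (if l' = l then 1 else 0) * avg p (fun u => F u u) := by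
  have h1 : 0 ≤ avg p (fun u => F u u) := avg_nonneg hp fun u => hF u u
  have h2 : 0 ≤ avg p (fun u => avg p (F u)) := avg_nonneg hp fun u => avg_nonneg hp (hF u)
  by_cases h : l' = l
  · subst h
    rw [avg_iid_apply hp l' (fun u => F u u)]
    simp only [if_true]
    linarith
  · rw [avg_iid_apply₂ hp h]
    simp [h]

/-- The variance of an empirical mean over a product of two independent codebooks. -/
theorem avg_sq_sub_le {pU : U → ℝ} (hU : pU ∈ stdSimplex ℝ U) {pV : V → ℝ}
    (hV : pV ∈ stdSimplex ℝ V) {w : U → V → ℝ} (hw : ∀ u v, 0 ≤ w u v) {L1 L2 : ℕ}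
    (hL1 : 0 < L1) (hL2 : 0 < L2) :
    avg (iid pU) (fun cu : Fin L1 → U => avg (iid pV) fun cv : Fin L2 → V =>
      (avg pU (fun u => avg pV (w u)) - (∑ l1, ∑ l2, w (cu l1) (cv l2)) / (L1 * L2)) ^ 2)
    ≤ avg pU (fun u => avg pV fun v => w u v ^ 2) / (L1 * L2)
      + avg pU (fun u => avg pV (w u) ^ 2) / L1 + avg pV (fun v => avg pU (fun u => w u v) ^ 2) / L2
      := by
  set g := avg pU (fun u => avg pV (w u)) with hg
  set K := avg pU (fun u => avg pV fun v => w u v ^ 2)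
  set K1 := avg pU (fun u => avg pV (w u) ^ 2)
  set K2 := avg pV (fun v => avg pU (fun u => w u v) ^ 2)
  have hA : (0 : ℝ) < L1 := by exact_mod_cast hL1
  have hB : (0 : ℝ) < L2 := by exact_mod_cast hL2
  have mean : avg (iid pU) (fun cu : Fin L1 → U => avg (iid pV) fun cv : Fin L2 → V =>
      ∑ l1, ∑ l2, w (cu l1) (cv l2)) = L1 * (L2 * g) := by
    simp only [avg_sum]
    have : ∀ (l1 : Fin L1) (l2 : Fin L2), avg (iid pU) (fun cu : Fin L1 → U =>
        avg (iid pV) fun cv : Fin L2 → V => w (cu l1) (cv l2)) = g := by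
      intro l1 l2
      have inner : ∀ cu : Fin L1 → U, avg (iid pV) (fun cv : Fin L2 → V => w (cu l1) (cv l2))
          = avg pV (w (cu l1)) := fun cu => avg_iid_apply hV l2 (w (cu l1))
      simp only [inner]
      rw [avg_iid_apply hU l1 (fun u => avg pV (w u))]
    simp [this]
  have second : avg (iid pU) (fun cu : Fin L1 → U => avg (iid pV) fun cv : Fin L2 → V =>
      (∑ l1, ∑ l2, w (cu l1) (cv l2)) ^ 2)
      ≤ L1 ^ 2 * L2 ^ 2 * g ^ 2 + L1 * L2 ^ 2 * K1 + L1 ^ 2 * L2 * K2 + L1 * L2 * K := by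
    have expand : ∀ (cu : Fin L1 → U) (cv : Fin L2 → V), (∑ l1, ∑ l2, w (cu l1) (cv l2)) ^ 2
        = ∑ l1, ∑ l1', ∑ l2, ∑ l2', w (cu l1) (cv l2) * w (cu l1') (cv l2') := by
      intro cu cv
      rw [sq, Finset.sum_mul_sum]
      exact Finset.sum_congr rfl fun l1 _ => Finset.sum_congr rfl fun l1' _ =>
        Finset.sum_mul_sum ..
    simp only [expand, avg_sum]
    -- Pairs of index pairs are sorted by which indices coincide. The term `g ^ 2`, present in all
    -- cases, cancels against the squared mean in `split`; coincidences produce `K1`, `K2` and `K`.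
    have term : ∀ (l1 l1' : Fin L1) (l2 l2' : Fin L2), avg (iid pU) (fun cu : Fin L1 → U =>
        avg (iid pV) fun cv : Fin L2 → V => w (cu l1) (cv l2) * w (cu l1') (cv l2'))
        ≤ g ^ 2 + (if l1' = l1 then 1 else 0) * K1 + (if l2' = l2 then 1 else 0) * K2
          + (if l1' = l1 then 1 else 0) * ((if l2' = l2 then 1 else 0) * K) := by
      intro l1 l1' l2 l2'
      set F : U → U → ℝ := fun u u' => avg pV (w u) * avg pV (w u')
        + (if l2' = l2 then 1 else 0) * avg pV (fun v => w u v * w u' v)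
      have hδ : (0 : ℝ) ≤ if l2' = l2 then 1 else 0 := by split_ifs <;> norm_num
      have hF : ∀ u u', 0 ≤ F u u' := fun u u' => add_nonneg
        (mul_nonneg (avg_nonneg hV (hw u)) (avg_nonneg hV (hw u')))
        (mul_nonneg hδ (avg_nonneg hV fun v => mul_nonneg (hw u v) (hw u' v)))
      calc _ ≤ avg (iid pU) (fun cu : Fin L1 → U => F (cu l1) (cu l1')) := by
            refine avg_mono (iid_mem hU L1) fun cu => ?_
            refine (avg_iid_pair_le hV l2 l2' (F := fun v v' => w (cu l1) v * w (cu l1') v')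
              fun v v' => mul_nonneg (hw _ _) (hw _ _)).trans_eq ?_
            simp only [avg_mul_left, avg_mul_right, F]
        _ ≤ _ := avg_iid_pair_le hU l1 l1' hF
        _ = _ := by
            simp only [F, avg_add, avg_mul_left, avg_mul_right]
            rw [show avg pU (fun u => avg pV (w u)) = g from rfl]
            have hK2 : avg pU (fun u => avg pU fun u' => avg pV fun v => w u v * w u' v) = K2 := by
              simp only [avg_comm pU pV, avg_mul_left, avg_mul_right, K2, sq]
            rw [hK2]
            simp only [← sq]
            ring
    refine (Finset.sum_le_sum fun l1 _ => Finset.sum_le_sum fun l1' _ => Finset.sum_le_sum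
      fun l2 _ => Finset.sum_le_sum fun l2' _ => term l1 l1' l2 l2').trans_eq ?_
    simp only [Finset.sum_add_distrib, ← Finset.sum_mul, ← Finset.mul_sum, Finset.sum_const,
      Finset.card_univ, Fintype.card_fin, nsmul_eq_mul, Finset.sum_ite_eq', Finset.mem_univ,
      if_true, mul_one]
    ring
  have split : avg (iid pU) (fun cu : Fin L1 → U => avg (iid pV) fun cv : Fin L2 → V =>
      (g - (∑ l1, ∑ l2, w (cu l1) (cv l2)) / (L1 * L2)) ^ 2)
      = g ^ 2 - 2 * g * (L1 * (L2 * g)) / (L1 * L2)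
        + avg (iid pU) (fun cu : Fin L1 → U => avg (iid pV) fun cv : Fin L2 → V =>
          (∑ l1, ∑ l2, w (cu l1) (cv l2)) ^ 2) / (L1 * L2) ^ 2 := by
    have : ∀ x : ℝ, (g - x / (L1 * L2)) ^ 2
        = g ^ 2 - (2 * g / (L1 * L2)) * x + x ^ 2 / (L1 * L2) ^ 2 := by
      intro x; ring
    simp only [this, avg_add, avg_sub, avg_mul_left, avg_div, avg_const (iid_mem hU L1),
      avg_const (iid_mem hV L2), mean]
    ring
  rw [split]
  have : avg (iid pU) (fun cu : Fin L1 → U => avg (iid pV) fun cv : Fin L2 → V =>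
          (∑ l1, ∑ l2, w (cu l1) (cv l2)) ^ 2) / (L1 * L2) ^ 2
      ≤ (L1 ^ 2 * L2 ^ 2 * g ^ 2 + L1 * L2 ^ 2 * K1 + L1 ^ 2 * L2 * K2 + L1 * L2 * K)
        / (L1 * L2) ^ 2 := by gcongr
  refine (add_le_add_right this _).trans_eq ?_
  field_simp
  ring

/-- Jensen's inequality, used once for each average, brings the square inside; after exchanging the
averages, `avg_sq_sub_le` applies for each fixed `s`. -/
theorem covering {pS : S → ℝ} (hS : pS ∈ stdSimplex ℝ S) {pU : U → ℝ} (hU : pU ∈ stdSimplex ℝ U)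
    {pV : V → ℝ} (hV : pV ∈ stdSimplex ℝ V) {w : S → U → V → ℝ} (hw : ∀ s u v, 0 ≤ w s u v)
    {c c1 c2 : ℝ} (hc : avg pS (fun s => avg pU fun u => avg pV fun v => w s u v ^ 2) ≤ c)
    (hc1 : avg pS (fun s => avg pU fun u => avg pV (w s u) ^ 2) ≤ c1)
    (hc2 : avg pS (fun s => avg pV fun v => avg pU (fun u => w s u v) ^ 2) ≤ c2)
    {L1 L2 : ℕ} (hL1 : 0 < L1) (hL2 : 0 < L2) :
    avg (iid pU) (fun cu : Fin L1 → U => avg (iid pV) fun cv : Fin L2 → V => avg pS fun s =>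
      |avg pU (fun u => avg pV (w s u)) - (∑ l1, ∑ l2, w s (cu l1) (cv l2)) / (L1 * L2)|)
    ≤ √(c / (L1 * L2) + c1 / L1 + c2 / L2) := by
  have hA : (0 : ℝ) < L1 := by exact_mod_cast hL1
  have hB : (0 : ℝ) < L2 := by exact_mod_cast hL2
  apply Real.le_sqrt_of_sq_le
  refine (sq_avg_le (iid_mem hU L1) _).trans ?_
  refine (avg_mono (iid_mem hU L1) fun cu => (sq_avg_le (iid_mem hV L2) _).trans
    (avg_mono (iid_mem hV L2) fun cv => sq_avg_le hS _)).trans ?_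
  simp only [sq_abs]
  simp only [avg_comm (iid pV) pS, avg_comm (iid pU) pS]
  refine (avg_mono hS fun s => avg_sq_sub_le hU hV (hw s) hL1 hL2).trans ?_
  simp only [avg_add, avg_div]
  gcongr

end Covering

/-! ### The random coding bound for one channel use. -/

section OneShot

variable {S U V X0 X1 X2 Y1 Y2 : Type*} [Fintype S] [Fintype U] [Fintype V] [Fintype X0]
  [Fintype X1] [Fintype X2] [Fintype Y1] [Fintype Y2]

/-- The decoder of user 1 involves neither `cv` nor `c2`; averaging them out turns `κ` into a kernel
to which `avg_testDecoder_error_le` applies. -/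
theorem avg_sum_testDecoder_error_le {pU : U → ℝ} (hU : pU ∈ stdSimplex ℝ U) {pV : V → ℝ}
    (hV : pV ∈ stdSimplex ℝ V) {q1 : X1 → ℝ} (hq1 : q1 ∈ stdSimplex ℝ X1) {q2 : X2 → ℝ}
    (hq2 : q2 ∈ stdSimplex ℝ X2) {κ : U → V → X1 → X2 → Y1 → Y2 → ℝ}
    (hκ : ∀ u v x1 x2 y1 y2, 0 ≤ κ u v x1 x2 y1 y2) {J : U → X1 → Y1 → ℝ}
    (hJ0 : ∀ u x y, 0 ≤ J u x y)
    (hkJ : ∀ u x y, pU u * (q1 x * avg pV fun v => avg q2 fun x2 => ∑ y2, κ u v x x2 y y2)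
      ≤ J u x y)
    (hJ1 : ∑ u, ∑ x, ∑ y, J u x y ≤ 1)
    {a b : ℝ} (ha : 0 < a) (hb : 0 < b) (T : U → X1 → Y1 → Prop)
    (hTa : ∀ u x y, T u x y → a * (pU u * (q1 x * ∑ u, ∑ x, J u x y)) ≤ J u x y)
    (hTb : ∀ u x y, T u x y → b * (q1 x * ∑ x, J u x y) ≤ J u x y)
    {L1 L2 M1 M2 : ℕ} (l1 : Fin L1) (l2 : Fin L2) (m1 : Fin M1) (m2 : Fin M2) :
    avg (iid pU) (fun cu : Fin L1 → U => avg (iid pV) fun cv : Fin L2 → V =>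
      avg (iid q1) fun c1 : Fin M1 → X1 => avg (iid q2) fun c2 : Fin M2 → X2 => ∑ y1, ∑ y2,
        κ (cu l1) (cv l2) (c1 m1) (c2 m2) y1 y2 * ind (testDecoder T cu c1 y1 ≠ some m1))
    ≤ ∑ u, ∑ x, ∑ y, J u x y * ind (¬T u x y) + ((M1 : ℝ) - 1) * (L1 / a + 1 / b) := by
  refine le_trans (le_of_eq ?_) (avg_testDecoder_error_le hU hq1
    (k := fun u x y => avg pV fun v => avg q2 fun x2 => ∑ y2, κ u v x x2 y y2)
    (fun u x y => avg_nonneg hV fun v => avg_nonneg hq2 fun x2 =>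
      Finset.sum_nonneg fun y2 _ => hκ _ _ _ _ _ _) hJ0 hkJ hJ1 ha hb T hTa hTb l1 m1)
  simp only [avg_comm (iid pV) (iid q1)]
  congr 1
  funext cu
  congr 1
  funext c1
  have h2 : ∀ cv : Fin L2 → V, avg (iid q2) (fun c2 : Fin M2 → X2 => ∑ y1, ∑ y2,
        κ (cu l1) (cv l2) (c1 m1) (c2 m2) y1 y2 * ind (testDecoder T cu c1 y1 ≠ some m1))
      = avg q2 fun x2 => ∑ y1, ∑ y2,
        κ (cu l1) (cv l2) (c1 m1) x2 y1 y2 * ind (testDecoder T cu c1 y1 ≠ some m1) :=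
    fun cv => avg_iid_apply hq2 m2 fun x2 => ∑ y1, ∑ y2,
        κ (cu l1) (cv l2) (c1 m1) x2 y1 y2 * ind (testDecoder T cu c1 y1 ≠ some m1)
  simp only [h2]
  rw [avg_iid_apply hV l2 fun v => avg q2 fun x2 => ∑ y1, ∑ y2,
        κ (cu l1) v (c1 m1) x2 y1 y2 * ind (testDecoder T cu c1 y1 ≠ some m1)]
  simp only [avg_sum, avg_mul_right, Finset.sum_mul]

/-- The average error probability of a code for a single use of the channel. -/
def codeError (ch : Channel S X0 X1 X2 Y1 Y2) {M1 M2 : ℕ} (h : S → X0) (e1 : Fin M1 → X1)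
    (e2 : Fin M2 → X2) (d1 : Y1 → Option (Fin M1)) (d2 : Y2 → Option (Fin M2)) : ℝ :=
  (∑ m1, ∑ m2, ∑ s, ∑ y1, ∑ y2, if d1 y1 = some m1 ∧ d2 y2 = some m2 then 0
    else ch.state.1 s * (ch.trans (h s) (e1 m1) (e2 m2) s).1 (y1, y2)) / ((M1 : ℝ) * (M2 : ℝ))

/-- A minimiser of `e` replaces a random choice with weights `w`. With `Z` the normalised total
weight, `e x = e x * Z + e x * (1 - Z)`: the first part is at most the weighted mean, and the second
is paid for by the distance of `Z` from `g` and of `g` from `1`. -/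
theorem exists_le_avg_add {X : Type*} [Fintype X] [Nonempty X] {L1 L2 : ℕ}
    (hL1 : 0 < L1) (hL2 : 0 < L2)
    {w : Fin L1 → Fin L2 → X → ℝ} (hw : ∀ l1 l2 x, 0 ≤ w l1 l2 x) {e : X → ℝ}
    (he0 : ∀ x, 0 ≤ e x) (he1 : ∀ x, e x ≤ 1) {g : ℝ} (hg : g ≤ 1) :
    ∃ x, e x ≤ (∑ l1, ∑ l2, ∑ x, w l1 l2 x * e x) / (L1 * L2)
      + |g - (∑ l1, ∑ l2, ∑ x, w l1 l2 x) / (L1 * L2)| + (1 - g) := by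
  obtain ⟨x, hx⟩ := Finite.exists_min e
  refine ⟨x, ?_⟩
  set Z := (∑ l1, ∑ l2, ∑ x, w l1 l2 x) / ((L1 : ℝ) * L2)
  have h1 : e x * Z ≤ (∑ l1, ∑ l2, ∑ x, w l1 l2 x * e x) / ((L1 : ℝ) * L2) := by
    rw [← mul_div_assoc]
    refine div_le_div_of_nonneg_right ?_ (by positivity)
    simp only [Finset.mul_sum]
    refine Finset.sum_le_sum fun l1 _ => Finset.sum_le_sum fun l2 _ =>
      Finset.sum_le_sum fun x' _ => ?_
    rw [mul_comm]
    exact mul_le_mul_of_nonneg_left (hx x') (hw _ _ _)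
  have h2 : e x * (1 - Z) ≤ |g - Z| + (1 - g) := by
    have h3 : 1 - Z ≤ |g - Z| + (1 - g) := by linarith [le_abs_self (g - Z)]
    have h4 : 0 ≤ |g - Z| + (1 - g) := by linarith [abs_nonneg (g - Z)]
    exact (mul_le_mul_of_nonneg_left h3 (he0 x)).trans (mul_le_of_le_one_left h4 (he1 x))
  linarith

/-- A random coding bound for a single use of the channel, by a likelihood encoder at the helper
and threshold decoders. -/
theorem exists_codeError_le (ch : Channel S X0 X1 X2 Y1 Y2) (p : InputLaw S U V X0 X1 X2)
    {pU : U → ℝ} (hU : pU ∈ stdSimplex ℝ U) {pV : V → ℝ} (hV : pV ∈ stdSimplex ℝ V)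
    {Q : S → U → V → ℝ} (hQ : ∀ s u v, ∑ x0, ch.state.1 s * (p.aux s).1 (u, v, x0) = Q s u v)
    (hQU : ∀ s u v, pU u = 0 → Q s u v = 0) (hQV : ∀ s u v, pV v = 0 → Q s u v = 0)
    {J1 : U → X1 → Y1 → ℝ}
    (hJ1 : ∀ u x1 y1, ∑ v, ∑ x2, ∑ y2, ∑ s, ∑ x0, ch.state.1 s * ((p.aux s).1 (u, v, x0) *
      (p.input1.1 x1 * (p.input2.1 x2 * (ch.trans x0 x1 x2 s).1 (y1, y2)))) = J1 u x1 y1)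
    {J2 : V → X2 → Y2 → ℝ}
    (hJ2 : ∀ v x2 y2, ∑ u, ∑ x1, ∑ y1, ∑ s, ∑ x0, ch.state.1 s * ((p.aux s).1 (u, v, x0) *
      (p.input1.1 x1 * (p.input2.1 x2 * (ch.trans x0 x1 x2 s).1 (y1, y2)))) = J2 v x2 y2)
    (hJ1' : ∑ u, ∑ x, ∑ y, J1 u x y ≤ 1) (hJ2' : ∑ u, ∑ x, ∑ y, J2 u x y ≤ 1)
    (hQ' : ∑ s, ∑ u, ∑ v, Q s u v = 1)
    (G : S → U → V → Prop) {c c1 c2 : ℝ} (hc0 : 0 ≤ c) (hc10 : 0 ≤ c1) (hc20 : 0 ≤ c2)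
    (hc : ∀ s u v, G s u v → Q s u v ≤ c * (ch.state.1 s * (pU u * pV v)))
    (hc1 : ∀ s u v, G s u v → ∑ v, Q s u v ≤ c1 * (ch.state.1 s * pU u))
    (hc2 : ∀ s u v, G s u v → ∑ u, Q s u v ≤ c2 * (ch.state.1 s * pV v))
    (T1 : U → X1 → Y1 → Prop) {a1 b1 : ℝ} (ha1 : 0 < a1) (hb1 : 0 < b1)
    (hTa1 : ∀ u x y, T1 u x y → a1 * (pU u * (p.input1.1 x * ∑ u, ∑ x, J1 u x y)) ≤ J1 u x y)
    (hTb1 : ∀ u x y, T1 u x y → b1 * (p.input1.1 x * ∑ x, J1 u x y) ≤ J1 u x y)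
    (T2 : V → X2 → Y2 → Prop) {a2 b2 : ℝ} (ha2 : 0 < a2) (hb2 : 0 < b2)
    (hTa2 : ∀ u x y, T2 u x y → a2 * (pV u * (p.input2.1 x * ∑ u, ∑ x, J2 u x y)) ≤ J2 u x y)
    (hTb2 : ∀ u x y, T2 u x y → b2 * (p.input2.1 x * ∑ x, J2 u x y) ≤ J2 u x y)
    {L1 L2 M1 M2 : ℕ} (hL1 : 0 < L1) (hL2 : 0 < L2) (hM1 : 0 < M1) (hM2 : 0 < M2) :
    ∃ (h : S → X0) (e1 : Fin M1 → X1) (e2 : Fin M2 → X2) (d1 : Y1 → Option (Fin M1))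
      (d2 : Y2 → Option (Fin M2)), codeError ch h e1 e2 d1 d2 ≤
        (∑ u, ∑ x, ∑ y, J1 u x y * ind (¬T1 u x y) + ((M1 : ℝ) - 1) * (L1 / a1 + 1 / b1))
        + (∑ u, ∑ x, ∑ y, J2 u x y * ind (¬T2 u x y) + ((M2 : ℝ) - 1) * (L2 / a2 + 1 / b2))
        + √(c / (L1 * L2) + c1 / L1 + c2 / L2) + ∑ s, ∑ u, ∑ v, Q s u v * ind (¬G s u v) := by
  set pS := ch.state.1 with hpS
  have hS : pS ∈ stdSimplex ℝ S := ch.state.2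
  set q1 := p.input1.1
  have hq1 : q1 ∈ stdSimplex ℝ X1 := p.input1.2
  set q2 := p.input2.1
  have hq2 : q2 ∈ stdSimplex ℝ X2 := p.input2.2
  set A : S → U → V → X0 → ℝ := fun s u v x0 => (p.aux s).1 (u, v, x0) with hAdef
  have hA : ∀ s u v x0, 0 ≤ A s u v x0 := fun s u v x0 => (p.aux s).2.1 _
  have hA1 : ∀ s, ∑ u, ∑ v, ∑ x0, A s u v x0 = 1 := fun s => by
    have h := (p.aux s).2.2
    simpa only [Fintype.sum_prod_type] using h
  set W : X0 → X1 → X2 → S → Y1 → Y2 → ℝ := fun x0 x1 x2 s y1 y2 =>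
    (ch.trans x0 x1 x2 s).1 (y1, y2) with hWdef
  have hW : ∀ x0 x1 x2 s y1 y2, 0 ≤ W x0 x1 x2 s y1 y2 := fun x0 x1 x2 s y1 y2 =>
    (ch.trans x0 x1 x2 s).2.1 _
  have hW1 : ∀ x0 x1 x2 s, ∑ y1, ∑ y2, W x0 x1 x2 s y1 y2 = 1 := fun x0 x1 x2 s => by
    have h := (ch.trans x0 x1 x2 s).2.2
    rwa [Fintype.sum_prod_type] at h
  have hQ0 : ∀ s u v, 0 ≤ Q s u v := fun s u v => by
    rw [← hQ]
    exact Finset.sum_nonneg fun x0 _ => mul_nonneg (hS.1 s) (hA s u v x0)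
  have : Nonempty X0 := by
    obtain ⟨s⟩ : Nonempty S := by
      by_contra hne
      rw [not_nonempty_iff] at hne
      have := hS.2
      simp at this
    by_contra hne
    rw [not_nonempty_iff] at hne
    have := hA1 s
    simp at this
  have hUV : ∀ u v, 0 ≤ pU u * pV v := fun u v => mul_nonneg (hU.1 u) (hV.1 v)
  -- The unnormalised likelihood encoder, truncated to `G` to control its second moment. Where `pU u
  -- * pV v = 0` the division returns `0`, which is harmless since `Q` vanishes there by `hQU` and
  -- `hQV`.
  set ω : S → U → V → X0 → ℝ := fun s u v x0 => ind (G s u v) * A s u v x0 / (pU u * pV v) with hω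
  have hω0 : ∀ s u v x0, 0 ≤ ω s u v x0 := fun s u v x0 =>
    div_nonneg (mul_nonneg (ind_nonneg _) (hA s u v x0)) (hUV u v)
  have hωA : ∀ s u v x0, pU u * pV v * ω s u v x0 ≤ A s u v x0 := by
    intro s u v x0
    by_cases h0 : pU u * pV v = 0
    · rw [h0, zero_mul]
      exact hA s u v x0
    · simp only [hω]
      rw [mul_div_cancel₀ _ h0]
      exact mul_le_of_le_one_left (hA s u v x0) (ind_le_one _)
  set w : S → U → V → ℝ := fun s u v => ∑ x0, ω s u v x0 with hw
  have hw0 : ∀ s u v, 0 ≤ w s u v := fun s u v => Finset.sum_nonneg fun x0 _ => hω0 s u v x0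
  have hwQ : ∀ s u v, pS s * (pU u * (pV v * w s u v)) = Q s u v * ind (G s u v) := by
    intro s u v
    by_cases h0 : pU u * pV v = 0
    · have : Q s u v = 0 := (mul_eq_zero.1 h0).elim (hQU s u v) (hQV s u v)
      rw [this, ← mul_assoc (pU u), h0]
      ring
    · rw [← hQ, ← mul_assoc (pU u)]
      simp only [hw, hω, Finset.mul_sum, Finset.sum_mul]
      exact Finset.sum_congr rfl fun x0 _ => by rw [mul_div_cancel₀ _ h0]; ring
  have hg1 : ∀ s, avg pU (fun u => avg pV (w s u)) ≤ 1 := by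
    intro s
    rw [← hA1 s]
    simp only [avg, hw, Finset.mul_sum]
    exact Finset.sum_le_sum fun u _ => Finset.sum_le_sum fun v _ => Finset.sum_le_sum
      fun x0 _ => by rw [← mul_assoc]; exact hωA s u v x0
  have hgG : avg pS (fun s => 1 - avg pU (fun u => avg pV (w s u)))
      = ∑ s, ∑ u, ∑ v, Q s u v * ind (¬G s u v) := by
    rw [avg_sub, avg_const hS, ← hQ']
    simp only [avg, Finset.mul_sum, hwQ, ← Finset.sum_sub_distrib]
    refine Finset.sum_congr rfl fun s _ => Finset.sum_congr rfl fun u _ =>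
      Finset.sum_congr rfl fun v _ => ?_
    by_cases h : G s u v
    · rw [ind_of_true h, ind_of_false (not_not.2 h)]; ring
    · rw [ind_of_false h, ind_of_true h]; ring
  have hQsum : ∀ c : ℝ, ∑ s, ∑ u, ∑ v, c * Q s u v = c := fun c => by
    simp only [← Finset.mul_sum, hQ', mul_one]
  -- On `G`, `hc` says `w ≤ c` wherever the product weight is positive, so the second moment is at
  -- most `c` times the total mass of `Q`. The next two bounds treat the partial averages of `w` in
  -- the same way.
  have bc : avg pS (fun s => avg pU fun u => avg pV fun v => w s u v ^ 2) ≤ c := by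
    rw [← hQsum c]
    simp only [avg, Finset.mul_sum]
    refine Finset.sum_le_sum fun s _ => Finset.sum_le_sum fun u _ => Finset.sum_le_sum fun v _ => ?_
    have e : pS s * (pU u * (pV v * w s u v ^ 2)) = w s u v * (Q s u v * ind (G s u v)) := by
      rw [← hwQ]; ring
    rw [e]
    by_cases h : G s u v
    · rw [ind_of_true h, mul_one]
      by_cases h0 : pS s * (pU u * pV v) = 0
      · have : Q s u v = 0 := le_antisymm (by simpa [h0] using hc s u v h) (hQ0 s u v)
        simp [this]
      · have hpos : 0 < pS s * (pU u * pV v) :=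
          lt_of_le_of_ne (mul_nonneg (hS.1 s) (hUV u v)) (Ne.symm h0)
        refine mul_le_mul_of_nonneg_right ?_ (hQ0 s u v)
        have h1 := hwQ s u v
        rw [ind_of_true h, mul_one] at h1
        have h2 := hc s u v h
        rw [← h1] at h2
        refine le_of_mul_le_mul_left ?_ hpos
        linarith
    · rw [ind_of_false h]
      simpa using mul_nonneg hc0 (hQ0 s u v)
  have bc1 : avg pS (fun s => avg pU fun u => avg pV (w s u) ^ 2) ≤ c1 := by
    rw [← hQsum c1]
    simp only [← Finset.mul_sum]
    simp only [avg, Finset.mul_sum]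
    refine Finset.sum_le_sum fun s _ => Finset.sum_le_sum fun u _ => ?_
    rw [← Finset.mul_sum]
    set r := ∑ v, pV v * w s u v with hr
    have hr0 : 0 ≤ r := avg_nonneg hV (hw0 s u)
    have hQs0 : 0 ≤ ∑ v, Q s u v := Finset.sum_nonneg fun v _ => hQ0 s u v
    have h1 : pS s * (pU u * r) ≤ ∑ v, Q s u v := by
      simp only [hr, Finset.mul_sum, hwQ]
      exact Finset.sum_le_sum fun v _ => mul_le_of_le_one_right (hQ0 s u v) (ind_le_one _)
    have e : pS s * (pU u * r ^ 2) = r * (pS s * (pU u * r)) := by ring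
    rw [e]
    -- The inequality in `hc1` does not depend on `v`, so a single `v` in `G` gives it; if there is
    -- none, the truncation makes `r = 0`.
    by_cases hex : ∃ v, G s u v
    · obtain ⟨v, hv⟩ := hex
      have h2 := hc1 s u v hv
      rcases eq_or_lt_of_le (mul_nonneg (hS.1 s) (hU.1 u)) with h0 | hpos
      · rw [← mul_assoc (pS s), ← h0]
        simpa using mul_nonneg hc10 hQs0
      · have hrc : r ≤ c1 := le_of_mul_le_mul_left (by linarith) hpos
        exact mul_le_mul hrc h1 (mul_nonneg (hS.1 s) (mul_nonneg (hU.1 u) hr0)) hc10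
    · push Not at hex
      have : r = 0 := Finset.sum_eq_zero fun v _ => by
        simp [hw, hω, ind_of_false (hex v)]
      rw [this]
      simpa using mul_nonneg hc10 hQs0
  have bc2 : avg pS (fun s => avg pV fun v => avg pU (fun u => w s u v) ^ 2) ≤ c2 := by
    have hQ2 : ∑ s, ∑ v, ∑ u, c2 * Q s u v = c2 :=
      (Finset.sum_congr rfl fun s _ => Finset.sum_comm).trans (hQsum c2)
    rw [← hQ2]
    simp only [avg, Finset.mul_sum]
    refine Finset.sum_le_sum fun s _ => Finset.sum_le_sum fun v _ => ?_
    rw [← Finset.mul_sum]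
    set r := ∑ u, pU u * w s u v with hr
    have hr0 : 0 ≤ r := avg_nonneg hU fun u => hw0 s u v
    have hQs0 : 0 ≤ ∑ u, Q s u v := Finset.sum_nonneg fun u _ => hQ0 s u v
    have h1 : pS s * (pV v * r) ≤ ∑ u, Q s u v := by
      simp only [hr, Finset.mul_sum]
      refine Finset.sum_le_sum fun u _ => ?_
      rw [mul_left_comm (pV v), hwQ]
      exact mul_le_of_le_one_right (hQ0 s u v) (ind_le_one _)
    have e : pS s * (pV v * r ^ 2) = r * (pS s * (pV v * r)) := by ring
    rw [e]
    by_cases hex : ∃ u, G s u v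
    · obtain ⟨u, hu⟩ := hex
      have h2 := hc2 s u v hu
      rcases eq_or_lt_of_le (mul_nonneg (hS.1 s) (hV.1 v)) with h0 | hpos
      · rw [← mul_assoc (pS s), ← h0]
        simpa using mul_nonneg hc20 hQs0
      · have hrc : r ≤ c2 := le_of_mul_le_mul_left (by linarith) hpos
        exact mul_le_mul hrc h1 (mul_nonneg (hS.1 s) (mul_nonneg (hV.1 v) hr0)) hc20
    · push Not at hex
      have : r = 0 := Finset.sum_eq_zero fun u _ => by
        simp [hw, hω, ind_of_false (hex u)]
      rw [this]
      simpa using mul_nonneg hc20 hQs0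
  have hcov := covering hS hU hV hw0 bc bc1 bc2 hL1 hL2
  -- The output kernel for a fixed pair of helper words, not normalised. By `hωA` it is dominated by
  -- the true joint laws, as `hkJ1` and `hkJ2` record.
  set κ : U → V → X1 → X2 → Y1 → Y2 → ℝ := fun u v x1 x2 y1 y2 =>
    avg pS fun s => ∑ x0, ω s u v x0 * W x0 x1 x2 s y1 y2 with hκdef
  have hκ : ∀ u v x1 x2 y1 y2, 0 ≤ κ u v x1 x2 y1 y2 := fun u v x1 x2 y1 y2 =>
    avg_nonneg hS fun s => Finset.sum_nonneg fun x0 _ => mul_nonneg (hω0 _ _ _ _) (hW _ _ _ _ _ _)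
  have hterm0 : ∀ s u v x0 x1 x2 y1 y2,
      0 ≤ pS s * (A s u v x0 * (q1 x1 * (q2 x2 * W x0 x1 x2 s y1 y2))) :=
    fun s u v x0 x1 x2 y1 y2 => mul_nonneg (hS.1 _) (mul_nonneg (hA _ _ _ _)
      (mul_nonneg (hq1.1 _) (mul_nonneg (hq2.1 _) (hW _ _ _ _ _ _))))
  have hJ10 : ∀ u x y, 0 ≤ J1 u x y := fun u x y => by
    rw [← hJ1]
    exact Finset.sum_nonneg fun _ _ => Finset.sum_nonneg fun _ _ => Finset.sum_nonneg fun _ _ =>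
      Finset.sum_nonneg fun _ _ => Finset.sum_nonneg fun _ _ => hterm0 _ _ _ _ _ _ _ _
  have hJ20 : ∀ u x y, 0 ≤ J2 u x y := fun u x y => by
    rw [← hJ2]
    exact Finset.sum_nonneg fun _ _ => Finset.sum_nonneg fun _ _ => Finset.sum_nonneg fun _ _ =>
      Finset.sum_nonneg fun _ _ => Finset.sum_nonneg fun _ _ => hterm0 _ _ _ _ _ _ _ _
  have hkJ1 : ∀ u x y, pU u * (q1 x * avg pV fun v => avg q2 fun x2 => ∑ y2, κ u v x x2 y y2)
      ≤ J1 u x y := by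
    intro u x y
    rw [← hJ1]
    simp only [hκdef, avg, Finset.mul_sum]
    refine Finset.sum_le_sum fun v _ => Finset.sum_le_sum fun x2 _ => Finset.sum_le_sum fun y2 _ =>
      Finset.sum_le_sum fun s _ => Finset.sum_le_sum fun x0 _ => ?_
    calc _ = (pS s * (q1 x * (q2 x2 * W x0 x x2 s y y2))) * (pU u * pV v * ω s u v x0) := by ring
      _ ≤ (pS s * (q1 x * (q2 x2 * W x0 x x2 s y y2))) * A s u v x0 :=
        mul_le_mul_of_nonneg_left (hωA s u v x0) (mul_nonneg (hS.1 _)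
          (mul_nonneg (hq1.1 _) (mul_nonneg (hq2.1 _) (hW _ _ _ _ _ _))))
      _ = _ := by ring
  have hkJ2 : ∀ v x y, pV v * (q2 x * avg pU fun u => avg q1 fun x1 => ∑ y1, κ u v x1 x y1 y)
      ≤ J2 v x y := by
    intro v x y
    rw [← hJ2]
    simp only [hκdef, avg, Finset.mul_sum]
    refine Finset.sum_le_sum fun u _ => Finset.sum_le_sum fun x1 _ => Finset.sum_le_sum fun y1 _ =>
      Finset.sum_le_sum fun s _ => Finset.sum_le_sum fun x0 _ => ?_
    calc _ = (pS s * (q1 x1 * (q2 x * W x0 x1 x s y1 y))) * (pU u * pV v * ω s u v x0) := by ring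
      _ ≤ (pS s * (q1 x1 * (q2 x * W x0 x1 x s y1 y))) * A s u v x0 :=
        mul_le_mul_of_nonneg_left (hωA s u v x0) (mul_nonneg (hS.1 _)
          (mul_nonneg (hq1.1 _) (mul_nonneg (hq2.1 _) (hW _ _ _ _ _ _))))
      _ = _ := by ring
  set B1 := ∑ u, ∑ x, ∑ y, J1 u x y * ind (¬T1 u x y) + ((M1 : ℝ) - 1) * (L1 / a1 + 1 / b1)
  set B2 := ∑ u, ∑ x, ∑ y, J2 u x y * ind (¬T2 u x y) + ((M2 : ℝ) - 1) * (L2 / a2 + 1 / b2)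
  set D := ∑ s, ∑ u, ∑ v, Q s u v * ind (¬G s u v)
  have d1 : ∀ (l1 : Fin L1) (l2 : Fin L2) (m1 : Fin M1) (m2 : Fin M2),
      avg (iid pU) (fun cu : Fin L1 → U => avg (iid pV) fun cv : Fin L2 → V =>
      avg (iid q1) fun c1 : Fin M1 → X1 => avg (iid q2) fun c2 : Fin M2 → X2 => ∑ y1, ∑ y2,
        κ (cu l1) (cv l2) (c1 m1) (c2 m2) y1 y2 * ind (testDecoder T1 cu c1 y1 ≠ some m1)) ≤ B1 :=
    avg_sum_testDecoder_error_le hU hV hq1 hq2 hκ hJ10 hkJ1 hJ1' ha1 hb1 T1 hTa1 hTb1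
  have d2 : ∀ (l1 : Fin L1) (l2 : Fin L2) (m1 : Fin M1) (m2 : Fin M2),
      avg (iid pU) (fun cu : Fin L1 → U => avg (iid pV) fun cv : Fin L2 → V =>
      avg (iid q1) fun c1 : Fin M1 → X1 => avg (iid q2) fun c2 : Fin M2 → X2 => ∑ y1, ∑ y2,
        κ (cu l1) (cv l2) (c1 m1) (c2 m2) y1 y2 * ind (testDecoder T2 cv c2 y2 ≠ some m2)) ≤ B2 := by
    intro l1 l2 m1 m2
    refine le_trans (le_of_eq ?_) (avg_sum_testDecoder_error_le hV hU hq2 hq1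
      (κ := fun v u x2 x1 y2 y1 => κ u v x1 x2 y1 y2) (fun _ _ _ _ _ _ => hκ _ _ _ _ _ _)
      hJ20 hkJ2 hJ2' ha2 hb2 T2 hTa2 hTb2 l2 l1 m2 m1)
    rw [avg_comm (iid pU) (iid pV)]
    simp only [avg_comm (iid q1) (iid q2)]
    congr! 9
    exact Finset.sum_comm
  -- The error probability given `s` and `x0` for fixed codebooks; the helper will minimise it over
  -- `x0`.
  set e : (Fin L1 → U) → (Fin L2 → V) → (Fin M1 → X1) → (Fin M2 → X2) → S → X0 → ℝ :=
    fun cu cv c1 c2 s x0 => (∑ m1, ∑ m2, ∑ y1, ∑ y2, W x0 (c1 m1) (c2 m2) s y1 y2 *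
      ind (testDecoder T1 cu c1 y1 ≠ some m1 ∨ testDecoder T2 cv c2 y2 ≠ some m2)) / (M1 * M2)
    with hedef
  have hMM : (0 : ℝ) < M1 * M2 := by positivity
  have he0 : ∀ cu cv c1 c2 s x0, 0 ≤ e cu cv c1 c2 s x0 := fun cu cv c1 c2 s x0 =>
    div_nonneg (Finset.sum_nonneg fun _ _ => Finset.sum_nonneg fun _ _ => Finset.sum_nonneg
      fun _ _ => Finset.sum_nonneg fun _ _ => mul_nonneg (hW _ _ _ _ _ _) (ind_nonneg _)) hMM.le
  have he1 : ∀ cu cv c1 c2 s x0, e cu cv c1 c2 s x0 ≤ 1 := by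
    intro cu cv c1 c2 s x0
    rw [hedef]
    simp only
    rw [div_le_one hMM]
    calc _ ≤ ∑ m1, ∑ m2, ∑ y1, ∑ y2, W x0 (c1 m1) (c2 m2) s y1 y2 :=
          Finset.sum_le_sum fun _ _ => Finset.sum_le_sum fun _ _ => Finset.sum_le_sum fun _ _ =>
            Finset.sum_le_sum fun _ _ => mul_le_of_le_one_right (hW _ _ _ _ _ _) (ind_le_one _)
      _ = _ := by simp [hW1]
  have total : avg (iid pU) (fun cu : Fin L1 → U => avg (iid pV) fun cv : Fin L2 → V =>
      avg (iid q1) fun c1 : Fin M1 → X1 => avg (iid q2) fun c2 : Fin M2 → X2 => avg pS fun s =>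
        (∑ l1, ∑ l2, ∑ x0, ω s (cu l1) (cv l2) x0 * e cu cv c1 c2 s x0) / (L1 * L2)
        + |avg pU (fun u => avg pV (w s u)) - (∑ l1, ∑ l2, w s (cu l1) (cv l2)) / (L1 * L2)|
        + (1 - avg pU (fun u => avg pV (w s u)))) ≤ B1 + B2
        + √(c / (L1 * L2) + c1 / L1 + c2 / L2) + D := by
    have t1 : ∀ cu cv c1 c2, avg pS (fun s =>
        (∑ l1, ∑ l2, ∑ x0, ω s (cu l1) (cv l2) x0 * e cu cv c1 c2 s x0) / (L1 * L2))
        ≤ (∑ l1, ∑ l2, ∑ m1, ∑ m2,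
          ((∑ y1, ∑ y2, κ (cu l1) (cv l2) (c1 m1) (c2 m2) y1 y2 *
            ind (testDecoder T1 cu c1 y1 ≠ some m1))
          + ∑ y1, ∑ y2, κ (cu l1) (cv l2) (c1 m1) (c2 m2) y1 y2 *
            ind (testDecoder T2 cv c2 y2 ≠ some m2))) / (M1 * M2) / (L1 * L2) := by
      intro cu cv c1 c2
      rw [avg_div]
      refine div_le_div_of_nonneg_right ?_ (by positivity)
      have : avg pS (fun s => ∑ l1, ∑ l2, ∑ x0, ω s (cu l1) (cv l2) x0 * e cu cv c1 c2 s x0)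
          = (∑ l1, ∑ l2, ∑ m1, ∑ m2, ∑ y1, ∑ y2, κ (cu l1) (cv l2) (c1 m1) (c2 m2) y1 y2 *
            ind (testDecoder T1 cu c1 y1 ≠ some m1 ∨ testDecoder T2 cv c2 y2 ≠ some m2))
            / (M1 * M2) := by
        rw [eq_div_iff hMM.ne', ← avg_mul_right]
        simp only [avg_sum, Finset.sum_mul]
        refine Finset.sum_congr rfl fun l1 _ => Finset.sum_congr rfl fun l2 _ => ?_
        simp only [hκdef, ← avg_mul_right, ← avg_sum]
        congr 1
        funext s
        simp only [hedef, mul_assoc, div_mul_cancel₀ _ hMM.ne', Finset.mul_sum, Finset.sum_mul]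
        rw [Finset.sum_comm]
        refine Finset.sum_congr rfl fun m1 _ => ?_
        rw [Finset.sum_comm]
        refine Finset.sum_congr rfl fun m2 _ => ?_
        rw [Finset.sum_comm]
        refine Finset.sum_congr rfl fun y1 _ => ?_
        rw [Finset.sum_comm]
      rw [this]
      refine div_le_div_of_nonneg_right ?_ hMM.le
      simp only [← Finset.sum_add_distrib, ← mul_add]
      exact Finset.sum_le_sum fun _ _ => Finset.sum_le_sum fun _ _ => Finset.sum_le_sum fun _ _ =>
        Finset.sum_le_sum fun _ _ => Finset.sum_le_sum fun _ _ => Finset.sum_le_sum fun _ _ =>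
        mul_le_mul_of_nonneg_left (ind_or_le _ _) (hκ _ _ _ _ _ _)
    simp only [avg_add, avg_const (iid_mem hq1 M1), avg_const (iid_mem hq2 M2)]
    simp only [avg_const (iid_mem hU L1), avg_const (iid_mem hV L2)]
    rw [hgG]
    refine add_le_add_left (add_le_add ?_ hcov) _
    refine (avg_mono (iid_mem hU L1) fun cu => avg_mono (iid_mem hV L2) fun cv =>
      avg_mono (iid_mem hq1 M1) fun c1 => avg_mono (iid_mem hq2 M2) fun c2 =>
        t1 cu cv c1 c2).trans ?_
    -- The bound is uniform in the helper indices and the messages, so it survives averaging over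
    -- all of them.
    have key : ∀ (l1 : Fin L1) (l2 : Fin L2) (m1 : Fin M1) (m2 : Fin M2),
        avg (iid pU) (fun cu : Fin L1 → U => avg (iid pV) fun cv : Fin L2 → V =>
        avg (iid q1) fun c1 : Fin M1 → X1 => avg (iid q2) fun c2 : Fin M2 → X2 =>
          ((∑ y1, ∑ y2, κ (cu l1) (cv l2) (c1 m1) (c2 m2) y1 y2 *
            ind (testDecoder T1 cu c1 y1 ≠ some m1))
          + ∑ y1, ∑ y2, κ (cu l1) (cv l2) (c1 m1) (c2 m2) y1 y2 *
            ind (testDecoder T2 cv c2 y2 ≠ some m2))) ≤ B1 + B2 := by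
      intro l1 l2 m1 m2
      simp only [avg_add]
      exact add_le_add (d1 l1 l2 m1 m2) (d2 l1 l2 m1 m2)
    have hLL : (0 : ℝ) < L1 * L2 := by positivity
    simp only [avg_div]
    rw [div_le_iff₀ hLL, div_le_iff₀ hMM]
    have hsum := Finset.sum_le_sum fun l1 (_ : l1 ∈ (Finset.univ : Finset (Fin L1))) =>
      Finset.sum_le_sum fun l2 (_ : l2 ∈ (Finset.univ : Finset (Fin L2))) =>
      Finset.sum_le_sum fun m1 (_ : m1 ∈ (Finset.univ : Finset (Fin M1))) =>
      Finset.sum_le_sum fun m2 (_ : m2 ∈ (Finset.univ : Finset (Fin M2))) => key l1 l2 m1 m2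
    simp only [← avg_sum] at hsum
    refine hsum.trans_eq ?_
    simp only [Finset.sum_const, Finset.card_univ, Fintype.card_fin, nsmul_eq_mul]
    ring
  obtain ⟨cu, total⟩ := exists_le_of_avg_le (iid_mem hU L1) total
  obtain ⟨cv, total⟩ := exists_le_of_avg_le (iid_mem hV L2) total
  obtain ⟨c1, total⟩ := exists_le_of_avg_le (iid_mem hq1 M1) total
  obtain ⟨c2, total⟩ := exists_le_of_avg_le (iid_mem hq2 M2) total
  -- The codebooks are now deterministic, and the helper plays the best `x0` for each `s`.
  have hx : ∀ s, ∃ x0, e cu cv c1 c2 s x0 ≤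
      (∑ l1, ∑ l2, ∑ x0, ω s (cu l1) (cv l2) x0 * e cu cv c1 c2 s x0) / (L1 * L2)
      + |avg pU (fun u => avg pV (w s u)) - (∑ l1, ∑ l2, w s (cu l1) (cv l2)) / (L1 * L2)|
      + (1 - avg pU (fun u => avg pV (w s u))) := fun s =>
    exists_le_avg_add hL1 hL2 (fun l1 l2 x0 => hω0 s (cu l1) (cv l2) x0) (he0 cu cv c1 c2 s)
      (he1 cu cv c1 c2 s) (hg1 s)
  choose h hh using hx
  refine ⟨h, c1, c2, testDecoder T1 cu c1, testDecoder T2 cv c2,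
    le_trans (le_of_eq ?_) ((avg_mono hS hh).trans total)⟩
  simp only [codeError, hedef, avg_div]
  congr 1
  simp only [avg_sum]
  refine Finset.sum_congr rfl fun m1 _ => Finset.sum_congr rfl fun m2 _ => ?_
  simp only [← avg_sum]
  refine Finset.sum_congr rfl fun s _ => ?_
  simp only [Finset.mul_sum]
  refine Finset.sum_congr rfl fun y1 _ => Finset.sum_congr rfl fun y2 _ => ?_
  by_cases hd : testDecoder T1 cu c1 y1 = some m1 ∧ testDecoder T2 cv c2 y2 = some m2
  · rw [if_pos hd, ind_of_false (by tauto)]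
    ring
  · rw [if_neg hd, ind_of_true (by tauto), mul_one]

end OneShot

/-! ### Product channels and product input laws. -/

section Power

variable {S U V X0 X1 X2 Y1 Y2 α β γ : Type*} [Fintype S] [Fintype U] [Fintype V] [Fintype X0]
  [Fintype X1] [Fintype X2] [Fintype Y1] [Fintype Y2] [Fintype α] [Fintype β] [Fintype γ]

theorem prod_sum_pi {n : ℕ} (f : Fin n → α → ℝ) :
    ∏ i, ∑ a, f i a = ∑ c : Fin n → α, ∏ i, f i (c i) :=
  (sum_pi_prod f).symm

/-- The channel of `n` independent uses of `ch`. -/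
def Channel.power (ch : Channel S X0 X1 X2 Y1 Y2) (n : ℕ) :
    Channel (Fin n → S) (Fin n → X0) (Fin n → X1) (Fin n → X2) (Fin n → Y1) (Fin n → Y2) where
  state := ⟨iid ch.state.1, iid_mem ch.state.2 n⟩
  trans x0 x1 x2 s := ⟨fun y => ∏ i, (ch.trans (x0 i) (x1 i) (x2 i) (s i)).1 (y.1 i, y.2 i), by
    refine ⟨fun y => Finset.prod_nonneg fun i _ => (ch.trans _ _ _ _).2.1 _, ?_⟩
    have h : ∏ i, ∑ y1, ∑ y2, (ch.trans (x0 i) (x1 i) (x2 i) (s i)).1 (y1, y2) = 1 :=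
      Finset.prod_eq_one fun i _ => by
        rw [← Fintype.sum_prod_type]
        exact (ch.trans _ _ _ _).2.2
    simp only [prod_sum_pi] at h
    rw [Fintype.sum_prod_type]
    exact h⟩

/-- The law of `n` independent choices from `p`. -/
def InputLaw.power (p : InputLaw S U V X0 X1 X2) (n : ℕ) :
    InputLaw (Fin n → S) (Fin n → U) (Fin n → V) (Fin n → X0) (Fin n → X1) (Fin n → X2) where
  aux s := ⟨fun a => ∏ i, (p.aux (s i)).1 (a.1 i, a.2.1 i, a.2.2 i), by
    refine ⟨fun y => Finset.prod_nonneg fun i _ => (p.aux _).2.1 _, ?_⟩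
    have h : ∏ i, ∑ u, ∑ v, ∑ x0, (p.aux (s i)).1 (u, v, x0) = 1 :=
      Finset.prod_eq_one fun i _ => by
        simpa only [Fintype.sum_prod_type] using (p.aux (s i)).2.2
    simp only [prod_sum_pi] at h
    simp only [Fintype.sum_prod_type]
    exact h⟩
  input1 := ⟨iid p.input1.1, iid_mem p.input1.2 n⟩
  input2 := ⟨iid p.input2.1, iid_mem p.input2.2 n⟩

end Power

/-! ### The law of large numbers for log-likelihood ratios. -/

section LargeNumbers

variable {Ω α β γ : Type*} [Fintype Ω] [Fintype α] [Fintype β] [Fintype γ]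

/-- Independence and zero mean remove the off-diagonal terms. -/
theorem avg_iid_sum_sq {P : Ω → ℝ} (hP : P ∈ stdSimplex ℝ Ω) {h : Ω → ℝ} (h0 : avg P h = 0)
    (n : ℕ) : avg (iid P) (fun c : Fin n → Ω => (∑ i, h (c i)) ^ 2)
      = n * avg P (fun a => h a ^ 2) := by
  have e : ∀ c : Fin n → Ω, (∑ i, h (c i)) ^ 2 = ∑ i, ∑ j, h (c i) * h (c j) := fun c => by
    rw [sq, Finset.sum_mul_sum]
  simp only [e, avg_sum]
  have t : ∀ i j : Fin n, avg (iid P) (fun c : Fin n → Ω => h (c i) * h (c j))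
      = if i = j then avg P (fun a => h a ^ 2) else 0 := by
    intro i j
    split_ifs with hij
    · subst hij
      simp only [sq]
      exact avg_iid_apply hP i (fun a => h a * h a)
    · rw [avg_iid_mul hP (Ne.symm hij), h0, zero_mul]
  simp [t]

/-- The weak law of large numbers for a finite alphabet. -/
theorem tendsto_avg_iid_ind {P : Ω → ℝ} (hP : P ∈ stdSimplex ℝ Ω) (f : Ω → ℝ) {r : ℝ}
    (hr : r < avg P f) :
    Tendsto (fun n : ℕ => avg (iid P) (fun c : Fin n → Ω => ind (∑ i, f (c i) ≤ n * r)))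
      atTop (𝓝 0) := by
  set μ := avg P f
  set h : Ω → ℝ := fun a => f a - μ with hh
  have h0 : avg P h = 0 := by simp only [hh, avg_sub, avg_const hP, μ, sub_self]
  set σ := avg P (fun a => h a ^ 2)
  set δ := μ - r
  have hδ : 0 < δ := sub_pos.2 hr
  have lim : Tendsto (fun n : ℕ => (σ / δ ^ 2) / (n : ℝ)) atTop (𝓝 0) :=
    tendsto_const_div_atTop_nhds_zero_nat _
  refine tendsto_of_tendsto_of_tendsto_of_le_of_le' tendsto_const_nhds lim
    (Eventually.of_forall fun n => avg_nonneg (iid_mem hP n) fun c => ind_nonneg _) ?_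
  filter_upwards [eventually_gt_atTop 0] with n hn
  have hn' : (0 : ℝ) < n := by exact_mod_cast hn
  -- Chebyshev's inequality: on the event, the centred sum is at most `-(n * δ)`.
  have step : ∀ c : Fin n → Ω, ind (∑ i, f (c i) ≤ n * r)
      ≤ (∑ i, h (c i)) ^ 2 * (1 / (n * δ) ^ 2) := by
    intro c
    by_cases hc : ∑ i, f (c i) ≤ n * r
    · rw [ind_of_true hc, mul_one_div, le_div_iff₀ (by positivity), one_mul]
      have : ∑ i, h (c i) ≤ -(n * δ) := by
        simp only [hh, Finset.sum_sub_distrib, Finset.sum_const, Finset.card_univ,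
          Fintype.card_fin, nsmul_eq_mul, δ]
        linarith
      have h1 : 0 < n * δ := by positivity
      nlinarith
    · rw [ind_of_false hc]
      positivity
  refine (avg_mono (iid_mem hP n) step).trans_eq ?_
  rw [avg_mul_right, avg_iid_sum_sq hP h0]
  field_simp
  rfl

theorem sum_triple_pi {n : ℕ} (F : (Fin n → α × β × γ) → ℝ) :
    ∑ c, F c = ∑ a : Fin n → α, ∑ b : Fin n → β, ∑ d : Fin n → γ, F fun i => (a i, b i, d i) := by
  rw [← (Equiv.arrowProdEquivProdArrow (Fin n) (fun _ => α) (fun _ => β × γ)).symm.sum_comp,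
    Fintype.sum_prod_type]
  refine Finset.sum_congr rfl fun a _ => ?_
  rw [← (Equiv.arrowProdEquivProdArrow (Fin n) (fun _ => β) (fun _ => γ)).symm.sum_comp,
    Fintype.sum_prod_type]
  rfl

/-- The density of a law of triples concentrates around its mean on the exponential scale. -/
theorem tendsto_sum_ind_density {J : α → β → γ → ℝ} (hJ0 : ∀ a b c, 0 ≤ J a b c)
    (hJ1 : ∑ a, ∑ b, ∑ c, J a b c = 1) {num den : α → β → γ → ℝ}
    (hnum : ∀ a b c, J a b c ≠ 0 → 0 < num a b c) (hden : ∀ a b c, J a b c ≠ 0 → 0 < den a b c)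
    {r : ℝ} (hr : r < ∑ a, ∑ b, ∑ c, J a b c * Real.logb 2 (num a b c / den a b c)) :
    Tendsto (fun n : ℕ => ∑ a : Fin n → α, ∑ b : Fin n → β, ∑ c : Fin n → γ,
      (∏ i, J (a i) (b i) (c i)) * ind (¬ (2 : ℝ) ^ ((n : ℝ) * r) * (∏ i, den (a i) (b i) (c i))
        ≤ ∏ i, num (a i) (b i) (c i))) atTop (𝓝 0) := by
  set P : α × β × γ → ℝ := fun t => J t.1 t.2.1 t.2.2 with hPdef
  have hP : P ∈ stdSimplex ℝ (α × β × γ) :=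
    ⟨fun t => hJ0 _ _ _, by simpa only [Fintype.sum_prod_type] using hJ1⟩
  set f : α × β × γ → ℝ := fun t =>
    Real.logb 2 (num t.1 t.2.1 t.2.2 / den t.1 t.2.1 t.2.2) with hf
  have hr' : r < avg P f := by simpa only [avg, Fintype.sum_prod_type] using hr
  refine squeeze_zero (fun n => Finset.sum_nonneg fun a _ => Finset.sum_nonneg fun b _ =>
    Finset.sum_nonneg fun c _ => mul_nonneg (Finset.prod_nonneg fun i _ => hJ0 _ _ _)
      (ind_nonneg _)) (fun n => ?_) (tendsto_avg_iid_ind hP f hr')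
  rw [avg, sum_triple_pi]
  refine Finset.sum_le_sum fun a _ => Finset.sum_le_sum fun b _ => Finset.sum_le_sum fun c _ => ?_
  simp only [iid, hPdef]
  -- Sequences of mass zero do not contribute; on the others all factors of `num` and `den` are
  -- positive, so the logarithm of the product splits into a sum.
  by_cases hz : ∏ i, J (a i) (b i) (c i) = 0
  · simp [hz]
  · refine mul_le_mul_of_nonneg_left ?_ (Finset.prod_nonneg fun i _ => hJ0 _ _ _)
    by_cases hle : (2 : ℝ) ^ ((n : ℝ) * r) * (∏ i, den (a i) (b i) (c i))
        ≤ ∏ i, num (a i) (b i) (c i)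
    · rw [ind_of_false (not_not.2 hle)]
      exact ind_nonneg _
    · have hJi : ∀ i, J (a i) (b i) (c i) ≠ 0 := fun i =>
        Finset.prod_ne_zero_iff.1 hz i (Finset.mem_univ i)
      have hn : 0 < ∏ i, num (a i) (b i) (c i) := Finset.prod_pos fun i _ => hnum _ _ _ (hJi i)
      have hd : 0 < ∏ i, den (a i) (b i) (c i) := Finset.prod_pos fun i _ => hden _ _ _ (hJi i)
      have key : ∑ i, f (a i, b i, c i) ≤ n * r := by
        simp only [hf]
        rw [← Real.logb_prod _ _ fun i _ =>
          (div_pos (hnum _ _ _ (hJi i)) (hden _ _ _ (hJi i))).ne', Finset.prod_div_distrib,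
          Real.logb_le_iff_le_rpow one_lt_two (div_pos hn hd), div_le_iff₀ hd]
        exact (not_le.1 hle).le
      rw [ind_of_true key]
      exact ind_le_one _

end LargeNumbers

/-! ### Exponential decay of the error terms. -/

section Rates

theorem tendsto_two_rpow {r : ℝ} (hr : r < 0) :
    Tendsto (fun n : ℕ => (2 : ℝ) ^ ((n : ℝ) * r)) atTop (𝓝 0) := by
  have h : ∀ n : ℕ, (2 : ℝ) ^ ((n : ℝ) * r) = ((2 : ℝ) ^ r) ^ n := fun n => by
    rw [mul_comm, Real.rpow_mul (by norm_num), Real.rpow_natCast]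
  simp only [h]
  exact tendsto_pow_atTop_nhds_zero_of_lt_one (by positivity)
    (Real.rpow_lt_one_of_one_lt_of_neg one_lt_two hr)

theorem le_numMessages (R : ℝ) (n : ℕ) : (2 : ℝ) ^ ((n : ℝ) * R) ≤ numMessages R n :=
  Nat.le_ceil _

theorem numMessages_pos (R : ℝ) (n : ℕ) : 0 < numMessages R n :=
  Nat.ceil_pos.2 (by positivity)

theorem numMessages_sub_one_le (R : ℝ) (n : ℕ) :
    (numMessages R n : ℝ) - 1 ≤ (2 : ℝ) ^ ((n : ℝ) * R) := by
  have := (Nat.ceil_lt_add_one (a := (2 : ℝ) ^ ((n : ℝ) * R)) (by positivity)).le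
  rw [numMessages]
  linarith

theorem numMessages_le_two_mul {R : ℝ} (hR : 0 ≤ R) (n : ℕ) :
    (numMessages R n : ℝ) ≤ 2 * (2 : ℝ) ^ ((n : ℝ) * R) := by
  have h1 := numMessages_sub_one_le R n
  have h2 : (1 : ℝ) ≤ (2 : ℝ) ^ ((n : ℝ) * R) :=
    Real.one_le_rpow one_le_two (by positivity)
  linarith

/-- The exponents must lie below `A` and `B` for the tests to be typical, and above `R + r` and `R`
for the union bound to vanish. If `R = 0` there is only one message, the prefactor is zero, and
every choice of exponents works. -/
theorem exists_tendsto_wrong_message {R r A B : ℝ} (hr : 0 ≤ r)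
    (h : R = 0 ∨ (R + r < A ∧ R < B)) : ∃ a b, a < A ∧ b < B ∧
    Tendsto (fun n : ℕ => ((numMessages R n : ℝ) - 1) *
      (numMessages r n / (2 : ℝ) ^ ((n : ℝ) * a) + 1 / (2 : ℝ) ^ ((n : ℝ) * b))) atTop (𝓝 0) := by
  rcases h with h | ⟨h1, h2⟩
  · refine ⟨A - 1, B - 1, by linarith, by linarith, ?_⟩
    have : ∀ n, numMessages R n = 1 := fun n => by simp [numMessages, h]
    simp [this]
  · obtain ⟨a, ha1, ha2⟩ := exists_between h1
    obtain ⟨b, hb1, hb2⟩ := exists_between h2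
    refine ⟨a, b, ha2, hb2, ?_⟩
    have l1 := tendsto_two_rpow (r := R + r - a) (by linarith)
    have l2 := tendsto_two_rpow (r := R - b) (by linarith)
    have l := (l1.const_mul 2).add l2
    rw [mul_zero, add_zero] at l
    refine squeeze_zero (fun n => mul_nonneg ?_ (by positivity)) (fun n => ?_) l
    · rw [sub_nonneg]
      exact_mod_cast numMessages_pos R n
    · calc _ ≤ (2 : ℝ) ^ ((n : ℝ) * R) * (2 * (2 : ℝ) ^ ((n : ℝ) * r) / (2 : ℝ) ^ ((n : ℝ) * a)
            + 1 / (2 : ℝ) ^ ((n : ℝ) * b)) := by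
            gcongr
            · exact numMessages_sub_one_le R n
            · exact numMessages_le_two_mul hr n
        _ = _ := by
            simp only [mul_sub, mul_add, Real.rpow_sub two_pos, Real.rpow_add two_pos]
            ring

theorem tendsto_covering_failure {r1 r2 c c1 c2 : ℝ} (h : c < r1 + r2) (h1 : c1 < r1)
    (h2 : c2 < r2) :
    Tendsto (fun n : ℕ => √((2 : ℝ) ^ ((n : ℝ) * c) / (numMessages r1 n * numMessages r2 n)
      + (2 : ℝ) ^ ((n : ℝ) * c1) / numMessages r1 n + (2 : ℝ) ^ ((n : ℝ) * c2) / numMessages r2 n))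
      atTop (𝓝 0) := by
  have l := ((tendsto_two_rpow (r := c - (r1 + r2)) (by linarith)).add
    (tendsto_two_rpow (r := c1 - r1) (by linarith))).add
    (tendsto_two_rpow (r := c2 - r2) (by linarith))
  have l' := l.sqrt
  simp only [add_zero, Real.sqrt_zero] at l'
  refine squeeze_zero (fun n => Real.sqrt_nonneg _) (fun n => Real.sqrt_le_sqrt ?_) l'
  simp only [mul_sub, mul_add, Real.rpow_sub two_pos, Real.rpow_add two_pos]
  have k1 := le_numMessages r1 n
  have k2 := le_numMessages r2 n
  gcongr

end Rates

/-! ### From the one-shot bound to codes of length `n`. -/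

section Achievability

variable {S U V X0 X1 X2 Y1 Y2 : Type*} [Fintype S] [Fintype Y1] [Fintype Y2]

theorem errorProb_nonneg (ch : Channel S X0 X1 X2 Y1 Y2) {M1 M2 n : ℕ}
    (c : Code S X0 X1 X2 Y1 Y2 M1 M2 n) : 0 ≤ errorProb ch c := by
  refine div_nonneg (Finset.sum_nonneg fun m1 _ => Finset.sum_nonneg fun m2 _ =>
    Finset.sum_nonneg fun s _ => Finset.sum_nonneg fun y1 _ => Finset.sum_nonneg fun y2 _ => ?_)
    (by positivity)
  split_ifs
  · exact le_rfl
  · exact mul_nonneg (Finset.prod_nonneg fun i _ => ch.state.2.1 _)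
      (Finset.prod_nonneg fun i _ => (ch.trans _ _ _ _).2.1 _)

theorem achievable_of_tendsto (ch : Channel S X0 X1 X2 Y1 Y2) {R1 R2 : ℝ} (hR1 : 0 ≤ R1)
    (hR2 : 0 ≤ R2) {B : ℕ → ℝ} (hB : Tendsto B atTop (𝓝 0))
    (h : ∀ n, ∃ c : Code S X0 X1 X2 Y1 Y2 (numMessages R1 n) (numMessages R2 n) n,
      errorProb ch c ≤ B n) : Achievable ch (R1, R2) := by
  choose c hc using h
  exact ⟨hR1, hR2, c, squeeze_zero (fun n => errorProb_nonneg ch (c n)) hc hB⟩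

variable [Fintype U] [Fintype V] [Fintype X0] [Fintype X1] [Fintype X2]

theorem ind_not_and_le (p q : Prop) : ind (¬(p ∧ q)) ≤ ind (¬p) + ind (¬q) := by
  rw [not_and_or]
  exact ind_or_le _ _

/-- The test is the conjunction of two density tests, each typical by the law of large numbers. It
is formulated with letterwise marginals; since marginals of a product law are products of marginals,
this gives the inequalities that `exists_codeError_le` requires. -/
theorem exists_threshold_test {J : U → X1 → Y1 → ℝ} (hJ0 : ∀ u x y, 0 ≤ J u x y)
    (hJ : ∑ u, ∑ x, ∑ y, J u x y = 1) {pU : U → ℝ} (hU : ∀ u x y, J u x y ≠ 0 → 0 < pU u)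
    {q : X1 → ℝ} (hq : ∀ u x y, J u x y ≠ 0 → 0 < q x) {a b : ℝ}
    (ha : a < ∑ u, ∑ x, ∑ y, J u x y *
      Real.logb 2 (J u x y / (pU u * (q x * ∑ u, ∑ x, J u x y))))
    (hb : b < ∑ u, ∑ x, ∑ y, J u x y * Real.logb 2 (J u x y / (q x * ∑ x, J u x y))) :
    ∃ T : ∀ n : ℕ, (Fin n → U) → (Fin n → X1) → (Fin n → Y1) → Prop,
      (∀ n u x y, T n u x y → (2 : ℝ) ^ ((n : ℝ) * a) * (iid pU u * (iid q x *
        ∑ u : Fin n → U, ∑ x : Fin n → X1, ∏ i, J (u i) (x i) (y i)))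
          ≤ ∏ i, J (u i) (x i) (y i)) ∧
      (∀ n u x y, T n u x y → (2 : ℝ) ^ ((n : ℝ) * b) * (iid q x *
        ∑ x : Fin n → X1, ∏ i, J (u i) (x i) (y i)) ≤ ∏ i, J (u i) (x i) (y i)) ∧
      Tendsto (fun n => ∑ u : Fin n → U, ∑ x : Fin n → X1, ∑ y : Fin n → Y1,
        (∏ i, J (u i) (x i) (y i)) * ind (¬T n u x y)) atTop (𝓝 0) := by
  have hJpos : ∀ u x y, J u x y ≠ 0 → 0 < J u x y := fun u x y h =>
    lt_of_le_of_ne (hJ0 u x y) h.symm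
  have hUY : ∀ u x y, J u x y ≠ 0 → 0 < ∑ x, J u x y := fun u x y h =>
    (hJpos u x y h).trans_le (Finset.single_le_sum (f := fun x => J u x y)
      (fun x _ => hJ0 u x y) (Finset.mem_univ x))
  have hY : ∀ u x y, J u x y ≠ 0 → 0 < ∑ u, ∑ x, J u x y := fun u x y h =>
    (hUY u x y h).trans_le (Finset.single_le_sum (f := fun u => ∑ x, J u x y)
      (fun u _ => Finset.sum_nonneg fun x _ => hJ0 u x y) (Finset.mem_univ u))
  have la := tendsto_sum_ind_density hJ0 hJ hJpos (fun u x y h =>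
    mul_pos (hU u x y h) (mul_pos (hq u x y h) (hY u x y h))) ha
  have lb := tendsto_sum_ind_density hJ0 hJ hJpos (fun u x y h =>
    mul_pos (hq u x y h) (hUY u x y h)) hb
  refine ⟨fun n u x y =>
    (2 : ℝ) ^ ((n : ℝ) * a) * (∏ i, pU (u i) * (q (x i) * ∑ u, ∑ x, J u x (y i)))
      ≤ ∏ i, J (u i) (x i) (y i) ∧
    (2 : ℝ) ^ ((n : ℝ) * b) * (∏ i, q (x i) * ∑ x, J (u i) x (y i))
      ≤ ∏ i, J (u i) (x i) (y i), fun n u x y h => ?_, fun n u x y h => ?_, ?_⟩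
  · simpa only [iid, Finset.prod_mul_distrib, prod_sum_pi] using h.1
  · simpa only [iid, Finset.prod_mul_distrib, prod_sum_pi] using h.2
  · have l := la.add lb
    rw [add_zero] at l
    have hp : ∀ (n : ℕ) (u : Fin n → U) (x : Fin n → X1) (y : Fin n → Y1),
        0 ≤ ∏ i, J (u i) (x i) (y i) := fun n u x y => Finset.prod_nonneg fun i _ => hJ0 _ _ _
    refine squeeze_zero (fun n => Finset.sum_nonneg fun u _ => Finset.sum_nonneg fun x _ =>
      Finset.sum_nonneg fun y _ => mul_nonneg (hp n u x y) (ind_nonneg _)) (fun n => ?_) l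
    simp only [← Finset.sum_add_distrib, ← mul_add]
    exact Finset.sum_le_sum fun u _ => Finset.sum_le_sum fun x _ => Finset.sum_le_sum fun y _ =>
      mul_le_mul_of_nonneg_left (ind_not_and_le _ _) (hp n u x y)

/-- The counterpart of `exists_threshold_test` with densities bounded from above; the law of large
numbers is therefore applied to the inverse ratios, with the negated exponents supplied by `flip`.
-/
theorem exists_covering_set {pS : S → ℝ} {pU : U → ℝ} {pV : V → ℝ} {Q : S → U → V → ℝ}
    (hQ0 : ∀ s u v, 0 ≤ Q s u v) (hQ : ∑ s, ∑ u, ∑ v, Q s u v = 1)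
    (hS : ∀ s u v, Q s u v ≠ 0 → 0 < pS s) (hU : ∀ s u v, Q s u v ≠ 0 → 0 < pU u)
    (hV : ∀ s u v, Q s u v ≠ 0 → 0 < pV v) {c c1 c2 : ℝ}
    (hc : ∑ s, ∑ u, ∑ v, Q s u v * Real.logb 2 (Q s u v / (pS s * (pU u * pV v))) < c)
    (hc1 : ∑ s, ∑ u, ∑ v, Q s u v * Real.logb 2 ((∑ v, Q s u v) / (pS s * pU u)) < c1)
    (hc2 : ∑ s, ∑ u, ∑ v, Q s u v * Real.logb 2 ((∑ u, Q s u v) / (pS s * pV v)) < c2) :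
    ∃ G : ∀ n : ℕ, (Fin n → S) → (Fin n → U) → (Fin n → V) → Prop,
      (∀ n s u v, G n s u v → ∏ i, Q (s i) (u i) (v i)
        ≤ (2 : ℝ) ^ ((n : ℝ) * c) * (iid pS s * (iid pU u * iid pV v))) ∧
      (∀ n s u v, G n s u v → ∑ v : Fin n → V, ∏ i, Q (s i) (u i) (v i)
        ≤ (2 : ℝ) ^ ((n : ℝ) * c1) * (iid pS s * iid pU u)) ∧
      (∀ n s u v, G n s u v → ∑ u : Fin n → U, ∏ i, Q (s i) (u i) (v i)
        ≤ (2 : ℝ) ^ ((n : ℝ) * c2) * (iid pS s * iid pV v)) ∧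
      Tendsto (fun n => ∑ s : Fin n → S, ∑ u : Fin n → U, ∑ v : Fin n → V,
        (∏ i, Q (s i) (u i) (v i)) * ind (¬G n s u v)) atTop (𝓝 0) := by
  have hQpos : ∀ s u v, Q s u v ≠ 0 → 0 < Q s u v := fun s u v h =>
    lt_of_le_of_ne (hQ0 s u v) h.symm
  have hSU : ∀ s u v, Q s u v ≠ 0 → 0 < ∑ v, Q s u v := fun s u v h =>
    (hQpos s u v h).trans_le (Finset.single_le_sum (f := fun v => Q s u v)
      (fun v _ => hQ0 s u v) (Finset.mem_univ v))
  have hSV : ∀ s u v, Q s u v ≠ 0 → 0 < ∑ u, Q s u v := fun s u v h =>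
    (hQpos s u v h).trans_le (Finset.single_le_sum (f := fun u => Q s u v)
      (fun u _ => hQ0 s u v) (Finset.mem_univ u))
  have flip : ∀ (num den : S → U → V → ℝ) {r : ℝ},
      (∑ s, ∑ u, ∑ v, Q s u v * Real.logb 2 (num s u v / den s u v) < r) →
      -r < ∑ s, ∑ u, ∑ v, Q s u v * Real.logb 2 (den s u v / num s u v) := by
    intro num den r h
    have : ∀ s u v, Q s u v * Real.logb 2 (den s u v / num s u v)
        = -(Q s u v * Real.logb 2 (num s u v / den s u v)) := fun s u v => by
      rw [← inv_div (num s u v), Real.logb_inv, mul_neg]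
    simp only [this, Finset.sum_neg_distrib]
    exact neg_lt_neg h
  have lc := tendsto_sum_ind_density hQ0 hQ (fun s u v h => mul_pos (hS s u v h)
    (mul_pos (hU s u v h) (hV s u v h))) hQpos (flip _ _ hc)
  have lc1 := tendsto_sum_ind_density hQ0 hQ (fun s u v h => mul_pos (hS s u v h)
    (hU s u v h)) hSU (flip _ _ hc1)
  have lc2 := tendsto_sum_ind_density hQ0 hQ (fun s u v h => mul_pos (hS s u v h)
    (hV s u v h)) hSV (flip _ _ hc2)
  have cancel : ∀ (n : ℕ) (r x y : ℝ), (2 : ℝ) ^ ((n : ℝ) * -r) * x ≤ y →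
      x ≤ (2 : ℝ) ^ ((n : ℝ) * r) * y := by
    intro n r x y h
    rw [mul_neg, Real.rpow_neg zero_le_two, inv_mul_le_iff₀ (by positivity)] at h
    exact h
  refine ⟨fun n s u v => (2 : ℝ) ^ ((n : ℝ) * -c) * (∏ i, Q (s i) (u i) (v i))
      ≤ ∏ i, pS (s i) * (pU (u i) * pV (v i)) ∧
    ((2 : ℝ) ^ ((n : ℝ) * -c1) * (∏ i, ∑ v, Q (s i) (u i) v) ≤ ∏ i, pS (s i) * pU (u i) ∧
    (2 : ℝ) ^ ((n : ℝ) * -c2) * (∏ i, ∑ u, Q (s i) u (v i)) ≤ ∏ i, pS (s i) * pV (v i)),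
    fun n s u v h => ?_, fun n s u v h => ?_, fun n s u v h => ?_, ?_⟩
  · simpa only [iid, Finset.prod_mul_distrib] using cancel n _ _ _ h.1
  · simpa only [iid, Finset.prod_mul_distrib, prod_sum_pi] using cancel n _ _ _ h.2.1
  · simpa only [iid, Finset.prod_mul_distrib, prod_sum_pi] using cancel n _ _ _ h.2.2
  · have l := lc.add (lc1.add lc2)
    rw [add_zero, add_zero] at l
    have hp : ∀ (n : ℕ) (s : Fin n → S) (u : Fin n → U) (v : Fin n → V),
        0 ≤ ∏ i, Q (s i) (u i) (v i) := fun n u x y => Finset.prod_nonneg fun i _ => hQ0 _ _ _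
    refine squeeze_zero (fun n => Finset.sum_nonneg fun u _ => Finset.sum_nonneg fun x _ =>
      Finset.sum_nonneg fun y _ => mul_nonneg (hp n u x y) (ind_nonneg _)) (fun n => ?_) l
    simp only [← Finset.sum_add_distrib, ← mul_add]
    exact Finset.sum_le_sum fun u _ => Finset.sum_le_sum fun x _ => Finset.sum_le_sum fun y _ =>
      mul_le_mul_of_nonneg_left ((ind_not_and_le _ _).trans
        (add_le_add le_rfl (ind_not_and_le _ _))) (hp n u x y)

/-- Achievability with the rates `r1` and `r2` of the two helper codebooks. -/
theorem achievable_of_codebook_rates (ch : Channel S X0 X1 X2 Y1 Y2)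
    (p : InputLaw S U V X0 X1 X2) {pU : U → ℝ} {pV : V → ℝ} {Q : S → U → V → ℝ}
    (hQ : ∀ s u v, ∑ x0, ch.state.1 s * (p.aux s).1 (u, v, x0) = Q s u v)
    (hQU : ∀ u, ∑ s, ∑ v, Q s u v = pU u) (hQV : ∀ v, ∑ s, ∑ u, Q s u v = pV v)
    {J1 : U → X1 → Y1 → ℝ}
    (hJ1 : ∀ u x1 y1, ∑ v, ∑ x2, ∑ y2, ∑ s, ∑ x0, ch.state.1 s * ((p.aux s).1 (u, v, x0) *
      (p.input1.1 x1 * (p.input2.1 x2 * (ch.trans x0 x1 x2 s).1 (y1, y2)))) = J1 u x1 y1)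
    {J2 : V → X2 → Y2 → ℝ}
    (hJ2 : ∀ v x2 y2, ∑ u, ∑ x1, ∑ y1, ∑ s, ∑ x0, ch.state.1 s * ((p.aux s).1 (u, v, x0) *
      (p.input1.1 x1 * (p.input2.1 x2 * (ch.trans x0 x1 x2 s).1 (y1, y2)))) = J2 v x2 y2)
    (hJ1U : ∀ u, ∑ x, ∑ y, J1 u x y = pU u) (hJ2V : ∀ v, ∑ x, ∑ y, J2 v x y = pV v)
    {R1 R2 r1 r2 : ℝ} (hR1 : 0 ≤ R1) (hR2 : 0 ≤ R2) (hr1 : 0 ≤ r1) (hr2 : 0 ≤ r2)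
    (hc : ∑ s, ∑ u, ∑ v, Q s u v * Real.logb 2 (Q s u v / (ch.state.1 s * (pU u * pV v)))
      < r1 + r2)
    (hc1 : ∑ s, ∑ u, ∑ v, Q s u v * Real.logb 2 ((∑ v, Q s u v) / (ch.state.1 s * pU u)) < r1)
    (hc2 : ∑ s, ∑ u, ∑ v, Q s u v * Real.logb 2 ((∑ u, Q s u v) / (ch.state.1 s * pV v)) < r2)
    (h1 : R1 = 0 ∨ (R1 + r1 < ∑ u, ∑ x, ∑ y, J1 u x y *
        Real.logb 2 (J1 u x y / (pU u * (p.input1.1 x * ∑ u, ∑ x, J1 u x y))) ∧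
      R1 < ∑ u, ∑ x, ∑ y, J1 u x y *
        Real.logb 2 (J1 u x y / (p.input1.1 x * ∑ x, J1 u x y))))
    (h2 : R2 = 0 ∨ (R2 + r2 < ∑ u, ∑ x, ∑ y, J2 u x y *
        Real.logb 2 (J2 u x y / (pV u * (p.input2.1 x * ∑ u, ∑ x, J2 u x y))) ∧
      R2 < ∑ u, ∑ x, ∑ y, J2 u x y *
        Real.logb 2 (J2 u x y / (p.input2.1 x * ∑ x, J2 u x y)))) :
    Achievable ch (R1, R2) := by
  have hterm0 : ∀ s u v x0 x1 x2 y1 y2, 0 ≤ ch.state.1 s * ((p.aux s).1 (u, v, x0) *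
      (p.input1.1 x1 * (p.input2.1 x2 * (ch.trans x0 x1 x2 s).1 (y1, y2)))) :=
    fun s u v x0 x1 x2 y1 y2 => mul_nonneg (ch.state.2.1 _) (mul_nonneg ((p.aux s).2.1 _)
      (mul_nonneg (p.input1.2.1 _) (mul_nonneg (p.input2.2.1 _) ((ch.trans _ _ _ _).2.1 _))))
  have hJ10 : ∀ u x y, 0 ≤ J1 u x y := fun u x y => by
    rw [← hJ1]
    exact Finset.sum_nonneg fun _ _ => Finset.sum_nonneg fun _ _ => Finset.sum_nonneg fun _ _ =>
      Finset.sum_nonneg fun _ _ => Finset.sum_nonneg fun _ _ => hterm0 _ _ _ _ _ _ _ _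
  have hJ20 : ∀ u x y, 0 ≤ J2 u x y := fun u x y => by
    rw [← hJ2]
    exact Finset.sum_nonneg fun _ _ => Finset.sum_nonneg fun _ _ => Finset.sum_nonneg fun _ _ =>
      Finset.sum_nonneg fun _ _ => Finset.sum_nonneg fun _ _ => hterm0 _ _ _ _ _ _ _ _
  have hQ0 : ∀ s u v, 0 ≤ Q s u v := fun s u v => by
    rw [← hQ]
    exact Finset.sum_nonneg fun x0 _ => mul_nonneg (ch.state.2.1 s) ((p.aux s).2.1 _)
  have hQsum : ∑ s, ∑ u, ∑ v, Q s u v = 1 := by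
    simp only [← hQ, ← Finset.mul_sum]
    have h : ∀ s, ∑ u, ∑ v, ∑ x0, (p.aux s).1 (u, v, x0) = 1 := fun s => by
      simpa only [Fintype.sum_prod_type] using (p.aux s).2.2
    simp only [h, mul_one]
    exact ch.state.2.2
  have hU : pU ∈ stdSimplex ℝ U := by
    refine ⟨fun u => ?_, ?_⟩
    · rw [← hQU]
      exact Finset.sum_nonneg fun s _ => Finset.sum_nonneg fun v _ => hQ0 s u v
    · simp only [← hQU]
      rw [Finset.sum_comm]
      exact hQsum
  have hV : pV ∈ stdSimplex ℝ V := by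
    refine ⟨fun u => ?_, ?_⟩
    · rw [← hQV]
      exact Finset.sum_nonneg fun s _ => Finset.sum_nonneg fun v _ => hQ0 s v u
    · simp only [← hQV]
      rw [Finset.sum_comm, ← hQsum]
      exact Finset.sum_congr rfl fun s _ => Finset.sum_comm
  have hJ1sum : ∑ u, ∑ x, ∑ y, J1 u x y = 1 := by simp only [hJ1U, hU.2]
  have hJ2sum : ∑ u, ∑ x, ∑ y, J2 u x y = 1 := by simp only [hJ2V, hV.2]
  have hQU0 : ∀ s u v, pU u = 0 → Q s u v = 0 := by
    intro s u v h
    refine le_antisymm ?_ (hQ0 s u v)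
    rw [← h, ← hQU]
    exact (Finset.single_le_sum (f := fun v => Q s u v) (fun v _ => hQ0 s u v)
      (Finset.mem_univ v)).trans (Finset.single_le_sum (f := fun s => ∑ v, Q s u v)
      (fun s _ => Finset.sum_nonneg fun v _ => hQ0 s u v) (Finset.mem_univ s))
  have hQV0 : ∀ s u v, pV v = 0 → Q s u v = 0 := by
    intro s u v h
    refine le_antisymm ?_ (hQ0 s u v)
    rw [← h, ← hQV]
    exact (Finset.single_le_sum (f := fun u => Q s u v) (fun u _ => hQ0 s u v)
      (Finset.mem_univ u)).trans (Finset.single_le_sum (f := fun s => ∑ u, Q s u v)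
      (fun s _ => Finset.sum_nonneg fun u _ => hQ0 s u v) (Finset.mem_univ s))
  have pos : ∀ {x y : ℝ}, 0 ≤ y → (y = 0 → x = 0) → x ≠ 0 → 0 < y := fun hy h hx =>
    lt_of_le_of_ne hy fun h0 => hx (h h0.symm)
  have hJ1U0 : ∀ u x y, J1 u x y ≠ 0 → 0 < pU u := fun u x y => pos (hU.1 u) fun h => by
    refine le_antisymm ?_ (hJ10 u x y)
    rw [← h, ← hJ1U]
    exact (Finset.single_le_sum (f := fun y => J1 u x y) (fun y _ => hJ10 u x y)
      (Finset.mem_univ y)).trans (Finset.single_le_sum (f := fun x => ∑ y, J1 u x y)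
      (fun x _ => Finset.sum_nonneg fun y _ => hJ10 u x y) (Finset.mem_univ x))
  have hJ2V0 : ∀ u x y, J2 u x y ≠ 0 → 0 < pV u := fun u x y => pos (hV.1 u) fun h => by
    refine le_antisymm ?_ (hJ20 u x y)
    rw [← h, ← hJ2V]
    exact (Finset.single_le_sum (f := fun y => J2 u x y) (fun y _ => hJ20 u x y)
      (Finset.mem_univ y)).trans (Finset.single_le_sum (f := fun x => ∑ y, J2 u x y)
      (fun x _ => Finset.sum_nonneg fun y _ => hJ20 u x y) (Finset.mem_univ x))
  have hJ1X : ∀ u x y, J1 u x y ≠ 0 → 0 < p.input1.1 x := fun u x y =>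
    pos (p.input1.2.1 x) fun h => by simp [← hJ1, h]
  have hJ2X : ∀ u x y, J2 u x y ≠ 0 → 0 < p.input2.1 x := fun u x y =>
    pos (p.input2.2.1 x) fun h => by simp [← hJ2, h]
  have hQS : ∀ s u v, Q s u v ≠ 0 → 0 < ch.state.1 s := fun s u v =>
    pos (ch.state.2.1 s) fun h => by simp [← hQ, h]
  -- The strict inequalities leave room for exponents strictly between the rates and the information
  -- quantities.
  obtain ⟨a1, b1, ha1, hb1, lw1⟩ := exists_tendsto_wrong_message hr1 h1
  obtain ⟨a2, b2, ha2, hb2, lw2⟩ := exists_tendsto_wrong_message hr2 h2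
  obtain ⟨c, hc, hc'⟩ := exists_between hc
  obtain ⟨c1, hc1, hc1'⟩ := exists_between hc1
  obtain ⟨c2, hc2, hc2'⟩ := exists_between hc2
  obtain ⟨T1, hTa1, hTb1, lT1⟩ := exists_threshold_test hJ10 hJ1sum hJ1U0 hJ1X ha1 hb1
  obtain ⟨T2, hTa2, hTb2, lT2⟩ := exists_threshold_test hJ20 hJ2sum hJ2V0 hJ2X ha2 hb2
  obtain ⟨G, hG, hG1, hG2, lG⟩ := exists_covering_set hQ0 hQsum hQS
    (fun s u v => pos (hU.1 u) (hQU0 s u v)) (fun s u v => pos (hV.1 v) (hQV0 s u v)) hc hc1 hc2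
  have lim := (((lT1.add lw1).add (lT2.add lw2)).add
    (tendsto_covering_failure hc' hc1' hc2')).add lG
  simp only [add_zero] at lim
  refine achievable_of_tendsto ch hR1 hR2 lim fun n => ?_
  -- A code of length `n` for `ch` is a one-shot code for `ch.power n`.
  obtain ⟨h, e1, e2, d1, d2, hle⟩ := exists_codeError_le (ch.power n) (p.power n)
      (iid_mem hU n) (iid_mem hV n) (Q := fun s u v => ∏ i, Q (s i) (u i) (v i))
      (fun s u v => by
        simp only [← hQ, prod_sum_pi, Finset.prod_mul_distrib]
        rfl)
      (fun s u v h0 => by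
        obtain ⟨i, _, hi⟩ := Finset.prod_eq_zero_iff.1 h0
        exact Finset.prod_eq_zero (Finset.mem_univ i) (hQU0 _ _ _ hi))
      (fun s u v h0 => by
        obtain ⟨i, _, hi⟩ := Finset.prod_eq_zero_iff.1 h0
        exact Finset.prod_eq_zero (Finset.mem_univ i) (hQV0 _ _ _ hi))
      (J1 := fun u x y => ∏ i, J1 (u i) (x i) (y i))
      (fun u x y => by
        simp only [← hJ1, prod_sum_pi, Finset.prod_mul_distrib]
        rfl)
      (J2 := fun u x y => ∏ i, J2 (u i) (x i) (y i))
      (fun u x y => by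
        simp only [← hJ2, prod_sum_pi, Finset.prod_mul_distrib]
        rfl)
      (by
        have h : ∏ _i : Fin n, ∑ u, ∑ x, ∑ y, J1 u x y = 1 := by
          rw [hJ1sum, Finset.prod_const_one]
        simp only [prod_sum_pi] at h
        exact h.le)
      (by
        have h : ∏ _i : Fin n, ∑ u, ∑ x, ∑ y, J2 u x y = 1 := by
          rw [hJ2sum, Finset.prod_const_one]
        simp only [prod_sum_pi] at h
        exact h.le)
      (by
        have h : ∏ _i : Fin n, ∑ s, ∑ u, ∑ v, Q s u v = 1 := by
          rw [hQsum, Finset.prod_const_one]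
        simp only [prod_sum_pi] at h
        exact h)
      (G n) (c := (2 : ℝ) ^ ((n : ℝ) * c)) (c1 := (2 : ℝ) ^ ((n : ℝ) * c1))
      (c2 := (2 : ℝ) ^ ((n : ℝ) * c2)) (by positivity) (by positivity) (by positivity)
      (hG n) (hG1 n) (hG2 n)
      (T1 n) (a1 := (2 : ℝ) ^ ((n : ℝ) * a1)) (b1 := (2 : ℝ) ^ ((n : ℝ) * b1)) (by positivity)
      (by positivity) (hTa1 n) (hTb1 n)
      (T2 n) (a2 := (2 : ℝ) ^ ((n : ℝ) * a2)) (b2 := (2 : ℝ) ^ ((n : ℝ) * b2)) (by positivity)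
      (by positivity) (hTa2 n) (hTb2 n)
      (numMessages_pos r1 n) (numMessages_pos r2 n) (numMessages_pos R1 n) (numMessages_pos R2 n)
  exact ⟨⟨h, e1, e2, d1, d2⟩, hle⟩

end Achievability

/-! ### Identities and inequalities for the information measures. -/

section Laws

variable {Ω α β γ : Type*} [Fintype Ω]

theorem law_nonneg (P : stdSimplex ℝ Ω) (X : Ω → α) (a : α) : 0 ≤ law P X a :=
  Finset.sum_nonneg fun ω _ => by
    split_ifs
    · exact P.2.1 ω
    · exact le_rfl

theorem law_congr (P : stdSimplex ℝ Ω) {X : Ω → α} {Y : Ω → β} {a : α} {b : β}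
    (h : ∀ ω, X ω = a ↔ Y ω = b) : law P X a = law P Y b := by
  classical
  simp only [law, h]

theorem law_ne_zero_of_imp {P : stdSimplex ℝ Ω} {X : Ω → α} {Y : Ω → β} {a : α} {b : β}
    (h : ∀ ω, X ω = a → Y ω = b) (ha : law P X a ≠ 0) : law P Y b ≠ 0 := by
  have hle : law P X a ≤ law P Y b := Finset.sum_le_sum fun ω _ => by
    split_ifs with h1 h2
    · exact le_rfl
    · exact absurd (h ω h1) h2
    · exact P.2.1 ω
    · exact le_rfl
  exact ((lt_of_le_of_ne (law_nonneg P X a) ha.symm).trans_le hle).ne'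

theorem sum_law_right [Fintype β] (P : stdSimplex ℝ Ω) (X : Ω → α) (Y : Ω → β) (a : α) :
    ∑ b, law P (fun ω => (X ω, Y ω)) (a, b) = law P X a := by
  classical
  simp only [law, Prod.mk.injEq, ite_and]
  rw [Finset.sum_comm]
  refine Finset.sum_congr rfl fun ω _ => ?_
  by_cases h : X ω = a <;> simp [h]

theorem sum_law [Fintype α] (P : stdSimplex ℝ Ω) (X : Ω → α) : ∑ a, law P X a = 1 := by
  classical
  simp only [law]
  rw [Finset.sum_comm]
  simp only [Finset.sum_ite_eq, Finset.mem_univ, if_true]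
  exact P.2.2

theorem sum_law_left [Fintype α] (P : stdSimplex ℝ Ω) (X : Ω → α) (Y : Ω → β) (b : β) :
    ∑ a, law P (fun ω => (X ω, Y ω)) (a, b) = law P Y b := by
  rw [← sum_law_right P Y X b]
  exact Finset.sum_congr rfl fun a _ => law_congr P fun ω => by
    simp only [Prod.mk.injEq, and_comm]

variable [Fintype α] [Fintype β] [Fintype γ]

/-- Gibbs' inequality term by term, from `log t ≥ 1 - 1 / t`. Summed over two laws of equal mass it
gives nonnegativity of information. -/
theorem sub_div_log_two_le {p q : ℝ} (hp : 0 ≤ p) (hq : 0 ≤ q) (h : p ≠ 0 → q ≠ 0) :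
    (p - q) / Real.log 2 ≤ p * Real.logb 2 (p / q) := by
  have hl : 0 < Real.log 2 := Real.log_pos one_lt_two
  rw [Real.logb, ← mul_div_assoc]
  refine div_le_div_of_nonneg_right ?_ hl.le
  rcases eq_or_lt_of_le hp with h0 | hp'
  · simp [← h0, hq]
  · have hq' : 0 < q := lt_of_le_of_ne hq (h hp'.ne').symm
    have := mul_le_mul_of_nonneg_left (Real.one_sub_inv_le_log_of_pos (div_pos hp' hq')) hp
    rw [inv_div, mul_sub, mul_one, mul_div_cancel₀ _ hp'.ne'] at this
    exact this

theorem mutualInfo_nonneg (P : stdSimplex ℝ Ω) (X : Ω → α) (Y : Ω → β) : 0 ≤ mutualInfo P X Y := by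
  have h : ∑ a, ∑ b, (law P (fun ω => (X ω, Y ω)) (a, b) - law P X a * law P Y b) / Real.log 2
      = 0 := by
    simp only [← Finset.sum_div, Finset.sum_sub_distrib, sum_law_right, ← Finset.mul_sum, sum_law,
      mul_one, sub_self, zero_div, Finset.sum_const_zero]
  rw [← h]
  exact Finset.sum_le_sum fun a _ => Finset.sum_le_sum fun b _ =>
    sub_div_log_two_le (law_nonneg _ _ _) (mul_nonneg (law_nonneg _ _ _) (law_nonneg _ _ _))
      fun hab => mul_ne_zero
        (law_ne_zero_of_imp (fun ω hω => (Prod.mk.inj hω).1) hab)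
        (law_ne_zero_of_imp (fun ω hω => (Prod.mk.inj hω).2) hab)

theorem condMutualInfo_nonneg (P : stdSimplex ℝ Ω) (X : Ω → α) (Y : Ω → β) (Z : Ω → γ) :
    0 ≤ condMutualInfo P X Y Z := by
  -- The comparison law p(x,z) p(y,z) / p(z) has total mass one.
  have hq : ∑ a, ∑ b, ∑ c, law P (fun ω => (X ω, Z ω)) (a, c) * law P (fun ω => (Y ω, Z ω)) (b, c)
      / law P Z c = 1 := by
    rw [← sum_law P Z]
    simp only [Finset.sum_comm (s := (Finset.univ : Finset β)) (t := (Finset.univ : Finset γ))]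
    rw [Finset.sum_comm]
    refine Finset.sum_congr rfl fun c _ => ?_
    simp only [← Finset.sum_div, ← Finset.mul_sum, ← Finset.sum_mul, sum_law_left]
    -- This covers p(z) = 0 as well, since the quotient is then `0`.
    exact mul_self_div_self _
  have hp : ∑ a, ∑ b, ∑ c, law P (fun ω => (X ω, Y ω, Z ω)) (a, b, c) = 1 := by
    rw [← sum_law P (fun ω => (X ω, Y ω, Z ω))]
    simp only [Fintype.sum_prod_type]
  have h : ∑ a, ∑ b, ∑ c, (law P (fun ω => (X ω, Y ω, Z ω)) (a, b, c)
      - law P (fun ω => (X ω, Z ω)) (a, c) * law P (fun ω => (Y ω, Z ω)) (b, c) / law P Z c)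
      / Real.log 2 = 0 := by
    simp only [← Finset.sum_div, Finset.sum_sub_distrib]
    rw [hp, hq, sub_self, zero_div]
  rw [← h]
  refine Finset.sum_le_sum fun a _ => Finset.sum_le_sum fun b _ => Finset.sum_le_sum fun c _ => ?_
  rw [← div_div_eq_mul_div (law P (fun ω => (X ω, Y ω, Z ω)) (a, b, c))]
  exact sub_div_log_two_le (law_nonneg _ _ _)
    (div_nonneg (mul_nonneg (law_nonneg _ _ _) (law_nonneg _ _ _)) (law_nonneg _ _ _))
    fun habc => div_ne_zero (mul_ne_zero
      (law_ne_zero_of_imp (fun ω hω => by simp_all) habc)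
      (law_ne_zero_of_imp (fun ω hω => by simp_all) habc))
      (law_ne_zero_of_imp (fun ω hω => by simp_all) habc)

theorem mutualInfo_prod_right (P : stdSimplex ℝ Ω) (X : Ω → α) (Y : Ω → β) (Z : Ω → γ) :
    mutualInfo P X (fun ω => (Y ω, Z ω)) = mutualInfo P X Z + condMutualInfo P X Y Z := by
  have hXZ : ∀ a c, law P (fun ω => (X ω, Z ω)) (a, c)
      = ∑ b, law P (fun ω => (X ω, Y ω, Z ω)) (a, b, c) := fun a c => by
    rw [← sum_law_left P Y (fun ω => (X ω, Z ω)) (a, c)]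
    exact Finset.sum_congr rfl fun b _ => law_congr P fun ω => by
      simp only [Prod.mk.injEq]; tauto
  have e : mutualInfo P X Z = ∑ a, ∑ b, ∑ c, law P (fun ω => (X ω, Y ω, Z ω)) (a, b, c) *
      Real.logb 2 (law P (fun ω => (X ω, Z ω)) (a, c) / (law P X a * law P Z c)) := by
    refine Finset.sum_congr rfl fun a _ => ?_
    rw [Finset.sum_comm]
    refine Finset.sum_congr rfl fun c _ => ?_
    rw [← Finset.sum_mul, ← hXZ]
  rw [e, mutualInfo, condMutualInfo]
  simp only [Fintype.sum_prod_type, ← Finset.sum_add_distrib, ← mul_add]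
  refine Finset.sum_congr rfl fun a _ => Finset.sum_congr rfl fun b _ =>
    Finset.sum_congr rfl fun c _ => ?_
  by_cases h0 : law P (fun ω => (X ω, Y ω, Z ω)) (a, b, c) = 0
  · rw [h0, zero_mul, zero_mul]
  · have h1 : law P (fun ω => (X ω, Z ω)) (a, c) ≠ 0 :=
      law_ne_zero_of_imp (fun ω hω => by simp_all) h0
    have h2 : law P (fun ω => (Y ω, Z ω)) (b, c) ≠ 0 :=
      law_ne_zero_of_imp (fun ω hω => by simp_all) h0
    have h3 : law P Z c ≠ 0 := law_ne_zero_of_imp (fun ω hω => by simp_all) h0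
    have h4 : law P X a ≠ 0 := law_ne_zero_of_imp (fun ω hω => by simp_all) h0
    rw [← Real.logb_mul (div_ne_zero h1 (mul_ne_zero h4 h3))
      (div_ne_zero (mul_ne_zero h0 h3) (mul_ne_zero h1 h2))]
    congr 2
    field_simp

/-- The mutual information of a pair of independent variables with a third one. -/
theorem mutualInfo_indep_pair (P : stdSimplex ℝ Ω) (X : Ω → α) (Y : Ω → β) (Z : Ω → γ) {q : β → ℝ}
    (hq : ∀ a b, law P (fun ω => (X ω, Y ω)) (a, b) = law P X a * q b) :
    mutualInfo P (fun ω => (X ω, Y ω)) Z = ∑ a, ∑ b, ∑ c,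
      law P (fun ω => (X ω, Y ω, Z ω)) (a, b, c) *
      Real.logb 2 (law P (fun ω => (X ω, Y ω, Z ω)) (a, b, c) / (law P X a * (q b *
        ∑ a, ∑ b, law P (fun ω => (X ω, Y ω, Z ω)) (a, b, c)))) := by
  have hZ : ∀ c, ∑ a, ∑ b, law P (fun ω => (X ω, Y ω, Z ω)) (a, b, c) = law P Z c := by
    intro c
    rw [← sum_law_left P (fun ω => (X ω, Y ω)) Z c, Fintype.sum_prod_type]
    exact Finset.sum_congr rfl fun a _ => Finset.sum_congr rfl fun b _ =>
      law_congr P fun ω => by simp only [Prod.mk.injEq, and_assoc]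
  simp only [mutualInfo, Fintype.sum_prod_type, hZ, hq, mul_assoc]
  refine Finset.sum_congr rfl fun a _ => Finset.sum_congr rfl fun b _ =>
    Finset.sum_congr rfl fun c _ => ?_
  rw [law_congr P (X := fun ω => ((X ω, Y ω), Z ω)) (Y := fun ω => (X ω, Y ω, Z ω))
    (b := (a, b, c)) fun ω => by simp only [Prod.mk.injEq, and_assoc]]

/-- By independence p(x,y) = p(x) q(y), and p(x) cancels in the ratio wherever the joint law is
positive. -/
theorem condMutualInfo_indep (P : stdSimplex ℝ Ω) (X : Ω → α) (Y : Ω → β) (Z : Ω → γ) {q : β → ℝ}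
    (hq : ∀ a b, law P (fun ω => (X ω, Y ω)) (a, b) = law P X a * q b) :
    condMutualInfo P Y Z X = ∑ a, ∑ b, ∑ c,
      law P (fun ω => (X ω, Y ω, Z ω)) (a, b, c) *
      Real.logb 2 (law P (fun ω => (X ω, Y ω, Z ω)) (a, b, c) / (q b *
        ∑ b, law P (fun ω => (X ω, Y ω, Z ω)) (a, b, c))) := by
  have hXZ : ∀ a c, ∑ b, law P (fun ω => (X ω, Y ω, Z ω)) (a, b, c)
      = law P (fun ω => (Z ω, X ω)) (c, a) := by
    intro a c
    rw [← sum_law_left P Y (fun ω => (Z ω, X ω)) (c, a)]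
    exact Finset.sum_congr rfl fun b _ => law_congr P fun ω => by
      simp only [Prod.mk.injEq]; tauto
  have h1 : ∀ a b c, law P (fun ω => (Y ω, Z ω, X ω)) (b, c, a)
      = law P (fun ω => (X ω, Y ω, Z ω)) (a, b, c) := fun a b c =>
    law_congr P fun ω => by simp only [Prod.mk.injEq]; tauto
  have h2 : ∀ a b, law P (fun ω => (Y ω, X ω)) (b, a) = law P X a * q b := fun a b => by
    rw [← hq]
    exact law_congr P fun ω => by simp only [Prod.mk.injEq]; tauto
  simp only [condMutualInfo, h1, h2, hXZ]
  simp only [Finset.sum_comm (s := (Finset.univ : Finset γ)) (t := (Finset.univ : Finset α))]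
  rw [Finset.sum_comm]
  refine Finset.sum_congr rfl fun a _ => Finset.sum_congr rfl fun b _ =>
    Finset.sum_congr rfl fun c _ => ?_
  by_cases h0 : law P (fun ω => (X ω, Y ω, Z ω)) (a, b, c) = 0
  · rw [h0, zero_mul, zero_mul]
  · have h3 : law P X a ≠ 0 := law_ne_zero_of_imp (fun ω hω => by simp_all) h0
    rw [mul_comm _ (law P X a), mul_assoc (law P X a), mul_div_mul_left _ _ h3]

/-- The superfluous variable `Z` brings the information into the shape of the covering conditions of
`achievable_of_codebook_rates`. -/
theorem mutualInfo_eq_sum_triple (P : stdSimplex ℝ Ω) (X : Ω → α) (Y : Ω → β) (Z : Ω → γ) :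
    mutualInfo P Y X = ∑ a, ∑ b, ∑ c, law P (fun ω => (X ω, Y ω, Z ω)) (a, b, c) *
      Real.logb 2 ((∑ c, law P (fun ω => (X ω, Y ω, Z ω)) (a, b, c)) / (law P X a * law P Y b)) := by
  have h : ∀ a b, ∑ c, law P (fun ω => (X ω, Y ω, Z ω)) (a, b, c)
      = law P (fun ω => (Y ω, X ω)) (b, a) := by
    intro a b
    rw [← sum_law_right P (fun ω => (Y ω, X ω)) Z (b, a)]
    exact Finset.sum_congr rfl fun c _ => law_congr P fun ω => by
      simp only [Prod.mk.injEq]; tauto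
  simp only [← Finset.sum_mul, h]
  rw [mutualInfo, Finset.sum_comm]
  exact Finset.sum_congr rfl fun a _ => Finset.sum_congr rfl fun b _ => by
    rw [mul_comm (law P X a)]

/-- The ratio factors as p(x,y) / (p(x) p(y)) times p(x,y,z) / (p(z) p(x,y)). The second factor
contributes I(Z;Y,X), which the chain rule splits. The result is the threshold for the sum of the
two helper rates. -/
theorem sum_logb_density_triple (P : stdSimplex ℝ Ω) (X : Ω → α) (Y : Ω → β) (Z : Ω → γ) :
    ∑ a, ∑ b, ∑ c, law P (fun ω => (X ω, Y ω, Z ω)) (a, b, c) *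
      Real.logb 2 (law P (fun ω => (X ω, Y ω, Z ω)) (a, b, c)
        / (law P X a * (law P Y b * law P Z c)))
    = mutualInfo P Y X + mutualInfo P Z X + condMutualInfo P Z Y X := by
  have h : ∀ a b, ∑ c, law P (fun ω => (X ω, Y ω, Z ω)) (a, b, c)
      = law P (fun ω => (Y ω, X ω)) (b, a) := by
    intro a b
    rw [← sum_law_right P (fun ω => (Y ω, X ω)) Z (b, a)]
    exact Finset.sum_congr rfl fun c _ => law_congr P fun ω => by
      simp only [Prod.mk.injEq]; tauto
  have e : mutualInfo P Z (fun ω => (Y ω, X ω)) = ∑ a, ∑ b, ∑ c,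
      law P (fun ω => (X ω, Y ω, Z ω)) (a, b, c) *
      Real.logb 2 (law P (fun ω => (X ω, Y ω, Z ω)) (a, b, c) /
        (law P Z c * law P (fun ω => (Y ω, X ω)) (b, a))) := by
    rw [mutualInfo, Finset.sum_comm, Fintype.sum_prod_type, Finset.sum_comm]
    refine Finset.sum_congr rfl fun a _ => Finset.sum_congr rfl fun b _ =>
      Finset.sum_congr rfl fun c _ => ?_
    rw [law_congr P (X := fun ω => (Z ω, Y ω, X ω)) (Y := fun ω => (X ω, Y ω, Z ω))
      (b := (a, b, c)) fun ω => by simp only [Prod.mk.injEq]; tauto]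
  rw [add_assoc, ← mutualInfo_prod_right, e, mutualInfo_eq_sum_triple P X Y Z]
  simp only [← Finset.sum_add_distrib, ← mul_add, h]
  refine Finset.sum_congr rfl fun a _ => Finset.sum_congr rfl fun b _ =>
    Finset.sum_congr rfl fun c _ => ?_
  by_cases h0 : law P (fun ω => (X ω, Y ω, Z ω)) (a, b, c) = 0
  · rw [h0, zero_mul, zero_mul]
  · have h1 : law P X a ≠ 0 := law_ne_zero_of_imp (fun ω hω => by simp_all) h0
    have h2 : law P Y b ≠ 0 := law_ne_zero_of_imp (fun ω hω => by simp_all) h0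
    have h3 : law P Z c ≠ 0 := law_ne_zero_of_imp (fun ω hω => by simp_all) h0
    have h4 : law P (fun ω => (Y ω, X ω)) (b, a) ≠ 0 :=
      law_ne_zero_of_imp (fun ω hω => by simp_all) h0
    rw [← Real.logb_mul (div_ne_zero h4 (mul_ne_zero h1 h2))
      (div_ne_zero h0 (mul_ne_zero h3 h4))]
    congr 2
    field_simp

end Laws

/-! ### Elimination of the helper rates, and the two inclusions. -/

section Regions

/-- Fourier–Motzkin elimination. If `R1' < R1`, the value `B1 - (R1 + R1') / 2` lies strictly
between `B1 - R1`, which is at least `A1`, and `B1 - R1'`. If `R1' = 0`, nothing bounds `r1` from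
above and it can absorb `A`; this is where `A1` and `A2` being nonnegative matters. The same holds
for user 2. -/
theorem exists_codebook_rates {A1 A2 A B1 B2 R1 R2 R1' R2' : ℝ} (hA1 : 0 ≤ A1) (hA2 : 0 ≤ A2)
    (h1 : R1' = 0 ∨ R1' < R1) (h2 : R2' = 0 ∨ R2' < R2) (hB1 : R1 ≤ B1 - A1) (hB2 : R2 ≤ B2 - A2)
    (hB : R1 + R2 ≤ B1 + B2 - A) : ∃ r1 r2, A1 < r1 ∧ A2 < r2 ∧ A < r1 + r2 ∧
      (R1' = 0 ∨ R1' + r1 < B1) ∧ (R2' = 0 ∨ R2' + r2 < B2) := by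
  rcases h1 with h1 | h1
  · rcases h2 with h2 | h2
    · exact ⟨A1 + |A| + 1, A2 + 1, by linarith [abs_nonneg A], by linarith,
        by linarith [le_abs_self A], Or.inl h1, Or.inl h2⟩
    · exact ⟨A1 + |A| + 1, B2 - (R2 + R2') / 2, by linarith [abs_nonneg A], by linarith,
        by linarith [le_abs_self A], Or.inl h1, Or.inr (by linarith)⟩
  · rcases h2 with h2 | h2
    · exact ⟨B1 - (R1 + R1') / 2, A2 + |A| + 1, by linarith, by linarith [abs_nonneg A],
        by linarith [le_abs_self A], Or.inr (by linarith), Or.inl h2⟩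
    · exact ⟨B1 - (R1 + R1') / 2, B2 - (R2 + R2') / 2, by linarith, by linarith,
        by linarith, Or.inr (by linarith), Or.inr (by linarith)⟩

variable {S U V X0 X1 X2 Y1 Y2 : Type*} [Fintype S] [Fintype Y1] [Fintype Y2]

theorem sum_trans (ch : Channel S X0 X1 X2 Y1 Y2) (x0 : X0) (x1 : X1) (x2 : X2) (s : S) :
    ∑ y1, ∑ y2, (ch.trans x0 x1 x2 s).1 (y1, y2) = 1 := by
  have h := (ch.trans x0 x1 x2 s).2.2
  rwa [Fintype.sum_prod_type] at h

variable [Fintype U] [Fintype V] [Fintype X0] [Fintype X1] [Fintype X2]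

theorem sum_reorder {A B C D E : Type*} [Fintype A] [Fintype B] [Fintype C] [Fintype D] [Fintype E]
    (f : A → B → C → D → E → ℝ) :
    ∑ a, ∑ b, ∑ c, ∑ d, ∑ e, f a b c d e = ∑ b, ∑ d, ∑ e, ∑ a, ∑ c, f a b c d e := by
  rw [Finset.sum_comm]
  refine Finset.sum_congr rfl fun b _ => ?_
  have h1 : ∑ a, ∑ c, ∑ d, ∑ e, f a b c d e
      = ∑ x : A × C, ∑ y : D × E, f x.1 b x.2 y.1 y.2 := by simp only [Fintype.sum_prod_type]
  have h2 : ∑ d, ∑ e, ∑ a, ∑ c, f a b c d e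
      = ∑ y : D × E, ∑ x : A × C, f x.1 b x.2 y.1 y.2 := by simp only [Fintype.sum_prod_type]
  rw [h1, h2, Finset.sum_comm]

/-- Scaling by `1 - t` makes every positive rate strictly smaller and keeps a zero rate at zero,
which are the two cases allowed by `achievable_of_codebook_rates`. Letting `t` tend to `0` reaches
the given pair in the closure. -/
theorem rateRegion_subset_capacityRegion (ch : Channel S X0 X1 X2 Y1 Y2)
    (p : InputLaw S U V X0 X1 X2) : rateRegion ch p ⊆ capacityRegion ch := by
  rintro ⟨R1, R2⟩ hR
  simp only [rateRegion, Set.mem_ofPred_eq, le_min_iff] at hR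
  set P := jointLaw ch p with hP
  set rvS : Sample S U V X0 X1 X2 Y1 Y2 → S := fun (s, _, _, _, _, _, _, _) => s
  set rvU : Sample S U V X0 X1 X2 Y1 Y2 → U := fun (_, u, _, _, _, _, _, _) => u
  set rvV : Sample S U V X0 X1 X2 Y1 Y2 → V := fun (_, _, v, _, _, _, _, _) => v
  set rvX1 : Sample S U V X0 X1 X2 Y1 Y2 → X1 := fun (_, _, _, _, x1, _, _, _) => x1
  set rvX2 : Sample S U V X0 X1 X2 Y1 Y2 → X2 := fun (_, _, _, _, _, x2, _, _) => x2
  set rvY1 : Sample S U V X0 X1 X2 Y1 Y2 → Y1 := fun (_, _, _, _, _, _, y1, _) => y1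
  set rvY2 : Sample S U V X0 X1 X2 Y1 Y2 → Y2 := fun (_, _, _, _, _, _, _, y2) => y2
  have hQ : ∀ s u v, ∑ x0, ch.state.1 s * (p.aux s).1 (u, v, x0)
      = law P (fun ω => (rvS ω, rvU ω, rvV ω)) (s, u, v) := by
    intro s u v
    classical
    simp only [law, hP, jointLaw, rvS, rvU, rvV, Fintype.sum_prod_type, Prod.mk.injEq, ite_and,
      Finset.sum_ite_irrel, Finset.sum_const_zero, Finset.sum_ite_eq', Finset.mem_univ, if_true,
      ← Finset.mul_sum, sum_trans, p.input1.2.2, p.input2.2.2, mul_one]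
  have hS : ∀ s, law P rvS s = ch.state.1 s := by
    intro s
    have h : ∑ u, ∑ v, ∑ x0, (p.aux s).1 (u, v, x0) = 1 := by
      simpa only [Fintype.sum_prod_type] using (p.aux s).2.2
    rw [← sum_law_right P rvS (fun ω => (rvU ω, rvV ω)) s, Fintype.sum_prod_type]
    simp only [← hQ, ← Finset.mul_sum, h, mul_one]
  have hQU : ∀ u, ∑ s, ∑ v, law P (fun ω => (rvS ω, rvU ω, rvV ω)) (s, u, v) = law P rvU u := by
    intro u
    rw [← sum_law_left P (fun ω => (rvS ω, rvV ω)) rvU u, Fintype.sum_prod_type]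
    exact Finset.sum_congr rfl fun s _ => Finset.sum_congr rfl fun v _ => law_congr P fun ω => by
      simp only [Prod.mk.injEq]; tauto
  have hQV : ∀ v, ∑ s, ∑ u, law P (fun ω => (rvS ω, rvU ω, rvV ω)) (s, u, v) = law P rvV v := by
    intro v
    rw [← sum_law_left P (fun ω => (rvS ω, rvU ω)) rvV v, Fintype.sum_prod_type]
    exact Finset.sum_congr rfl fun s _ => Finset.sum_congr rfl fun u _ => law_congr P fun ω => by
      simp only [Prod.mk.injEq]; tauto
  have hJ1 : ∀ u x1 y1, ∑ v, ∑ x2, ∑ y2, ∑ s, ∑ x0, ch.state.1 s * ((p.aux s).1 (u, v, x0) *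
      (p.input1.1 x1 * (p.input2.1 x2 * (ch.trans x0 x1 x2 s).1 (y1, y2))))
      = law P (fun ω => (rvU ω, rvX1 ω, rvY1 ω)) (u, x1, y1) := by
    intro u x1 y1
    classical
    simp only [law, hP, jointLaw, rvU, rvX1, rvY1, Fintype.sum_prod_type, Prod.mk.injEq, ite_and,
      Finset.sum_ite_irrel, Finset.sum_const_zero, Finset.sum_ite_eq', Finset.mem_univ, if_true]
    exact (sum_reorder _).symm
  have hJ2 : ∀ v x2 y2, ∑ u, ∑ x1, ∑ y1, ∑ s, ∑ x0, ch.state.1 s * ((p.aux s).1 (u, v, x0) *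
      (p.input1.1 x1 * (p.input2.1 x2 * (ch.trans x0 x1 x2 s).1 (y1, y2))))
      = law P (fun ω => (rvV ω, rvX2 ω, rvY2 ω)) (v, x2, y2) := by
    intro v x2 y2
    classical
    simp only [law, hP, jointLaw, rvV, rvX2, rvY2, Fintype.sum_prod_type, Prod.mk.injEq, ite_and,
      Finset.sum_ite_irrel, Finset.sum_const_zero, Finset.sum_ite_eq', Finset.mem_univ, if_true]
    exact (sum_reorder _).symm
  have hJ1U : ∀ u, ∑ x, ∑ y, law P (fun ω => (rvU ω, rvX1 ω, rvY1 ω)) (u, x, y) = law P rvU u := by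
    intro u
    rw [← sum_law_right P rvU (fun ω => (rvX1 ω, rvY1 ω)) u, Fintype.sum_prod_type]
  have hJ2V : ∀ v, ∑ x, ∑ y, law P (fun ω => (rvV ω, rvX2 ω, rvY2 ω)) (v, x, y) = law P rvV v := by
    intro v
    rw [← sum_law_right P rvV (fun ω => (rvX2 ω, rvY2 ω)) v, Fintype.sum_prod_type]
  have indU : ∀ u x, law P (fun ω => (rvU ω, rvX1 ω)) (u, x) = law P rvU u * p.input1.1 x := by
    intro u x
    rw [← hQU]
    simp only [← hQ]
    classical
    simp only [law, hP, jointLaw, rvU, rvX1, Fintype.sum_prod_type, Prod.mk.injEq, ite_and,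
      Finset.sum_ite_irrel, Finset.sum_const_zero, Finset.sum_ite_eq', Finset.mem_univ, if_true,
      ← Finset.mul_sum, sum_trans, p.input2.2.2, mul_one]
    simp only [← mul_assoc, ← Finset.sum_mul, Finset.mul_sum]
  have indV : ∀ v x, law P (fun ω => (rvV ω, rvX2 ω)) (v, x) = law P rvV v * p.input2.1 x := by
    intro v x
    rw [← hQV]
    simp only [← hQ]
    classical
    simp only [law, hP, jointLaw, rvV, rvX2, Fintype.sum_prod_type, Prod.mk.injEq, ite_and,
      Finset.sum_ite_irrel, Finset.sum_const_zero, Finset.sum_ite_eq', Finset.mem_univ, if_true,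
      ← Finset.mul_sum, sum_trans, mul_one, ← Finset.sum_mul, p.input1.2.2, one_mul]
    simp only [← mul_assoc, ← Finset.sum_mul, Finset.mul_sum]
  obtain ⟨h01, h02, ⟨hR1, hR1'⟩, ⟨hR2, hR2'⟩, hR12, -⟩ := hR
  have ach : ∀ t : ℝ, 0 < t → t < 1 → Achievable ch ((1 - t) * R1, (1 - t) * R2) := by
    intro t ht ht1
    have small : ∀ R : ℝ, 0 ≤ R → (1 - t) * R = 0 ∨ (1 - t) * R < R := by
      intro R hR
      rcases eq_or_lt_of_le hR with h | h
      · left; rw [← h, mul_zero]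
      · right; nlinarith
    obtain ⟨r1, r2, hr1, hr2, hr12, hc1, hc2⟩ := exists_codebook_rates
      (A := mutualInfo P rvU rvS + mutualInfo P rvV rvS + condMutualInfo P rvV rvU rvS)
      (mutualInfo_nonneg P rvU rvS) (mutualInfo_nonneg P rvV rvS) (small R1 h01) (small R2 h02)
      hR1 hR2 (by linarith)
    -- The covering condition for `V` sums out `u`, the middle coordinate, so the formula for
    -- triples is used with `U` and `V` exchanged.
    have h2UV : mutualInfo P rvV rvS = ∑ s, ∑ u, ∑ v,
        law P (fun ω => (rvS ω, rvU ω, rvV ω)) (s, u, v) *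
        Real.logb 2 ((∑ u, law P (fun ω => (rvS ω, rvU ω, rvV ω)) (s, u, v))
          / (law P rvS s * law P rvV v)) := by
      have hsw : ∀ s u v, law P (fun ω => (rvS ω, rvV ω, rvU ω)) (s, v, u)
          = law P (fun ω => (rvS ω, rvU ω, rvV ω)) (s, u, v) := fun s u v =>
        law_congr P fun ω => by simp only [Prod.mk.injEq]; tauto
      rw [mutualInfo_eq_sum_triple P rvS rvV rvU]
      simp only [hsw]
      exact Finset.sum_congr rfl fun s _ => Finset.sum_comm
    rw [← sum_logb_density_triple P rvS rvU rvV] at hr12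
    have n1 := (mutualInfo_nonneg P rvU rvS).trans hr1.le
    have n2 := (mutualInfo_nonneg P rvV rvS).trans hr2.le
    rw [mutualInfo_eq_sum_triple P rvS rvU rvV] at hr1
    rw [h2UV] at hr2
    simp only [hS] at hr1 hr2 hr12
    refine achievable_of_codebook_rates ch p hQ hQU hQV hJ1 hJ2 hJ1U hJ2V
      (mul_nonneg (by linarith) h01) (mul_nonneg (by linarith) h02) n1 n2 hr12 hr1 hr2 ?_ ?_
    · rw [← mutualInfo_indep_pair P rvU rvX1 rvY1 indU, ← condMutualInfo_indep P rvU rvX1 rvY1 indU]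
      rcases small R1 h01 with h | h
      · exact Or.inl h
      · exact hc1.imp_right fun hc => ⟨hc, h.trans_le hR1'⟩
    · rw [← mutualInfo_indep_pair P rvV rvX2 rvY2 indV, ← condMutualInfo_indep P rvV rvX2 rvY2 indV]
      rcases small R2 h02 with h | h
      · exact Or.inl h
      · exact hc2.imp_right fun hc => ⟨hc, h.trans_le hR2'⟩
  have lim : Tendsto (fun t : ℝ => ((1 - t) * R1, (1 - t) * R2)) (𝓝[>] 0) (𝓝 (R1, R2)) := by
    have hcont : Continuous fun t : ℝ => ((1 - t) * R1, (1 - t) * R2) := by fun_prop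
    simpa using (hcont.tendsto 0).mono_left nhdsWithin_le_nhds
  refine mem_closure_of_tendsto lim ?_
  filter_upwards [Ioo_mem_nhdsGT (zero_lt_one' ℝ)] with t ht
  exact ach t ht.1 ht.2

/-- By the chain rule, I(V;U,S) = I(V;S) + I(V;U|S). Dropping the nonnegative last term gives the
bound on `R2`, keeping it gives the first bound on the sum, and the second is the sum of two
individual bounds. -/
theorem successiveRateRegion_subset_rateRegion (ch : Channel S X0 X1 X2 Y1 Y2)
    (p : InputLaw S U V X0 X1 X2) : successiveRateRegion ch p ⊆ rateRegion ch p := by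
  rintro ⟨R1, R2⟩ hR
  simp only [successiveRateRegion, rateRegion, Set.mem_ofPred_eq, le_min_iff,
    mutualInfo_prod_right] at hR ⊢
  obtain ⟨h01, h02, ⟨h1, h1'⟩, h2, h2'⟩ := hR
  have hnn := condMutualInfo_nonneg (jointLaw ch p) (fun ω => ω.2.2.1) (fun ω => ω.2.1)
    (fun ω => ω.1)
  exact ⟨h01, h02, ⟨h1, h1'⟩, ⟨by linarith, h2'⟩, by linarith, by linarith⟩

end Regions

end HelperChannel

end

theorem proposition2 {S X0 X1 X2 Y1 Y2 : Type*} [Fintype S] [Fintype X0] [Fintype X1]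
    [Fintype X2] [Fintype Y1] [Fintype Y2] (ch : HelperChannel.Channel S X0 X1 X2 Y1 Y2) :
    HelperChannel.innerBound ch ⊆ HelperChannel.capacityRegion ch ∧
      HelperChannel.successiveInnerBound ch ⊆ HelperChannel.innerBound ch :=
  ⟨fun _ ⟨_, _, p, hR⟩ => HelperChannel.rateRegion_subset_capacityRegion ch p hR,
    fun _ ⟨k, l, p, hR⟩ =>
      ⟨k, l, p, HelperChannel.successiveRateRegion_subset_rateRegion ch p hR⟩⟩
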